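/- Let $\Theta$ be a Polish space with its Borel $\sigma$-algebra, $P_0$ a diffuse (atomless) probability measure on $\Theta$, $q_M$ a probability distribution on $\{1,2,3,\dots\}$ and, for $j=1,\dots,d$, let $H_j({\rm d}s)=h_j(s)\,{\rm d}s$ be a probability distribution on $\mathbb{R}^+=(0,\infty)$ with a Lebesgue density $h_j$ and Laplace transform $\psi_j(u)=\int_0^\infty e^{-us}h_j(s)\,{\rm d}s$. For a probability distribution $q$ on $\{0,1,2,\dots\}$ and a product $G=G_1\times\dots\times G_d$ of probability distributions on $\mathbb{R}^+$, we say that a vector of random measures $(\mu_1,\dots,\mu_d)$ on $\Theta$ is a $\operatorname{Vec-IFPP}(q,G,P_0)$ if it has the law of $\mu_j=\sum_{m=1}^M S_{j,m}\delta_{\tau_m}$, $j=1,\dots,d$, where $M\sim q$ and, given $M$, all the $S_{j,m}$ and $\tau_m$ ($j\le d$, $m\le M$) are independent with $S_{j,m}\sim G_j$ and $\tau_m\sim P_0$. Let $(\mu_1,\dots,\mu_d)$ be a $\operatorname{Vec-IFPP}(q_M,H_1\times\dots\times H_d,P_0)$, let $T_j=\mu_j(\Theta)$, let $P_j=\mu_j/T_j$,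 and let $n_1,\dots,n_d\ge 1$. Conditionally on $(\mu_1,\dots,\mu_d)$, let the random variables $\theta_{j,i}$ and $U_j$ ($j=1,\dots,d$, $i=1,\dots,n_j$) be independent, with $\theta_{j,i}\sim P_j$ and $U_j\sim\operatorname{Gamma}(n_j,T_j)$ (shape $n_j$, rate $T_j$). Put $\boldsymbol\theta=(\theta_{j,i})_{j,i}$ and $\boldsymbol U_n=(U_1,\dots,U_d)$. Denote by $\theta^{**}_1,\dots,\theta^{**}_K$ the distinct values in the whole array $\boldsymbol\theta$, $K$ being their number, and let $n_{j,k}\ge 0$ be the number of indices $i\le n_j$ with $\theta_{j,i}=\theta^{**}_k$. Then, for almost every value of $(\boldsymbol\theta,\boldsymbol U_n)$, with $\boldsymbol U_n=(u_1,\dots,u_d)$, the conditional distribution of $(\mu_1,\dots,\mu_d)$ given $(\boldsymbol\theta,\boldsymbol U_n)$ is the law of the sum of two independent vectors of random measures, \[ (\mu_1,\dots,\mu_d)\mid\boldsymbol\theta,\boldsymbol U_n\ \overset{d}{=}\ (\mu^{(a)}_1,\dots,\mu^{(a)}_d)+(\mu^{(na)}_1,\dots,\mu^{(na)}_d), \]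 where: (i) (allocated components) $\mu^{(a)}_j=\sum_{k=1}^K S^{(a)}_{j,k}\,\delta_{\theta^{**}_k}$ for $j=1,\dots,d$, where the random variables $S^{(a)}_{j,k}$ ($j\le d$, $k\le K$) are independent and $S^{(a)}_{j,k}$ has a density on $\mathbb{R}^+$ proportional to $e^{-u_js}s^{n_{j,k}}h_j(s)$; (ii) (non-allocated components) $(\mu^{(na)}_1,\dots,\mu^{(na)}_d)$ is a $\operatorname{Vec-IFPP}(q^*_M,H^*,P_0)$ with $H^*=H^*_1\times\dots\times H^*_d$, \[ H^*_j({\rm d}s)\propto e^{-u_js}h_j(s)\,{\rm d}s,\qquad q^*_M(m)\propto q_M(m+K)\,\frac{(m+K)!}{m!}\prod_{j=1}^d\psi_j(u_j)^m,\quad m=0,1,2,\dots \] -/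

import Mathlib

open MeasureTheory ProbabilityTheory
open scoped ENNReal Nat

noncomputable section

/-- `HasCondLaw Y X law P`: under `P`, the conditional distribution of `Y` given `X = x` is `law x`;
that is, some regular version `κ` of this conditional distribution is equal to `law x` for almost
every value `x` of `X`. -/
def HasCondLaw {Ω α β : Type*} [MeasurableSpace Ω] [MeasurableSpace α] [MeasurableSpace β]
    (Y : Ω → β) (X : Ω → α) (law : α → Measure β) (P : Measure Ω) : Prop :=
  ∃ κ : Kernel α β, IsMarkovKernel κ ∧ HasCondDistrib Y X κ P ∧ ∀ᵐ ω ∂P, κ (X ω) = law (X ω)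

/-- The measure on `(0, ∞)`, seen as a measure on `ℝ`, with Lebesgue density `f`. -/
def densityLaw (f : ℝ → ℝ) : Measure ℝ :=
  (volume.restrict (Set.Ioi 0)).withDensity (fun s => ENNReal.ofReal (f s))

/-- The probability measure proportional to `ν`. -/
def normalized {α : Type*} [MeasurableSpace α] (ν : Measure α) : Measure α :=
  (ν Set.univ)⁻¹ • ν

/-- The vector of measures `(∑ k, s j k • δ_{x k})_j` with weights `s j k` and common atoms `x k`. -/
def weightedAtoms {Θ ι : Type*} [MeasurableSpace Θ] [Fintype ι] {d : ℕ}
    (s : Fin d → ι → ℝ) (x : ι → Θ) : Fin d → Measure Θ :=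
  fun j => ∑ k, ENNReal.ofReal (s j k) • Measure.dirac (x k)

/-- `Vec-IFPP(q, H₁ × ⋯ × H_d, P₀)`, as the law of the vector `(μ₁, …, μ_d)`,
`μ_j = ∑_{m < M} S_{j,m} δ_{τ_m}`, where `M ∼ q` and, given `M`, all the `S_{j,m}` and `τ_m` are
independent with `S_{j,m} ∼ H_j` and `τ_m ∼ P₀`. -/
def vecIFPP {Θ : Type*} [MeasurableSpace Θ] {d : ℕ}
    (q : Measure ℕ) (H : Fin d → Measure ℝ) (P₀ : Measure Θ) : Measure (Fin d → Measure Θ) :=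
  Measure.sum fun m : ℕ => q {m} •
    ((Measure.pi fun j : Fin d => Measure.pi fun _ : Fin m => H j).prod
      (Measure.pi fun _ : Fin m => P₀)).map (fun p => weightedAtoms p.1 p.2)

/-- The conditional law of `(θ, U)` given `(μ₁, …, μ_d)`: the `θ_{j,i}`, `i < n_j`, have law
`P_j = μ_j / μ_j(Θ)`, the `U_j` have law `Gamma(n_j, T_j)` (shape `n_j`, rate `T_j = μ_j(Θ)`),
and all of them are independent. -/
def samplingLaw {Θ : Type*} [MeasurableSpace Θ] {d : ℕ} (n : Fin d → ℕ) (μ : Fin d → Measure Θ) :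
    Measure (((j : Fin d) → Fin (n j) → Θ) × (Fin d → ℝ)) :=
  (Measure.pi fun j => Measure.pi fun _ : Fin (n j) => normalized (μ j)).prod
    (Measure.pi fun j => gammaMeasure (n j) (μ j Set.univ).toReal)

open Classical in
/-- The set `{θ**_1, …, θ**_K}` of the distinct values in the array `θ`. -/
def distinctValues {Θ : Type*} {d : ℕ} {n : Fin d → ℕ} (θ : (j : Fin d) → Fin (n j) → Θ) :
    Finset Θ :=
  Finset.univ.image fun p : (j : Fin d) × Fin (n j) => θ p.1 p.2

open Classical in
/-- `n_{j,k}`: the number of observations of group `j` that are equal to the value `x = θ**_k`. -/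
def groupCount {Θ : Type*} {d : ℕ} {n : Fin d → ℕ} (θ : (j : Fin d) → Fin (n j) → Θ)
    (j : Fin d) (x : Θ) : ℕ :=
  (Finset.univ.filter fun i : Fin (n j) => θ j i = x).card

/-- The law of `(μ^(a)_1, …, μ^(a)_d)`, `μ^(a)_j = ∑_k S^(a)_{j,k} δ_{θ**_k}`, with independent
weights, the density of `S^(a)_{j,k}` being proportional to `exp(-u_j s) s ^ n_{j,k} h_j(s)`. -/
def allocatedLaw {Θ : Type*} [MeasurableSpace Θ] {d : ℕ} {n : Fin d → ℕ} (h : Fin d → ℝ → ℝ)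
    (θ : (j : Fin d) → Fin (n j) → Θ) (u : Fin d → ℝ) : Measure (Fin d → Measure Θ) :=
  (Measure.pi fun j : Fin d => Measure.pi fun x : distinctValues θ =>
      normalized (densityLaw fun s => Real.exp (-(u j * s)) * s ^ groupCount θ j x * h j s)).map
    (fun s => weightedAtoms s (fun x : distinctValues θ => (x : Θ)))

/-- The Laplace transform `ψ(u) = ∫ exp(-u s) H(ds)` of `H(ds) = h(s) ds`. -/
def laplaceTransform (h : ℝ → ℝ) (u : ℝ) : ℝ≥0∞ :=
  ∫⁻ s, ENNReal.ofReal (Real.exp (-(u * s))) ∂(densityLaw h)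

/-- The law `q*_M` on `{0, 1, 2, …}`, with
`q*_M(m) ∝ q_M(m + K) (m + K)! / m! ∏_j ψ_j(u_j) ^ m`. -/
def qStar {d : ℕ} (q : Measure ℕ) (h : Fin d → ℝ → ℝ) (K : ℕ) (u : Fin d → ℝ) : Measure ℕ :=
  normalized (Measure.count.withDensity fun m =>
    q {m + K} * (((m + K) ! : ℝ≥0∞) / (m ! : ℝ≥0∞)) * ∏ j, laplaceTransform (h j) (u j) ^ m)

/-- The law of the non-allocated part: `Vec-IFPP(q*_M, H*, P₀)` with
`H*_j(ds) ∝ exp(-u_j s) h_j(s) ds`. -/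
def nonallocatedLaw {Θ : Type*} [MeasurableSpace Θ] {d : ℕ} (q : Measure ℕ) (h : Fin d → ℝ → ℝ)
    (P₀ : Measure Θ) (K : ℕ) (u : Fin d → ℝ) : Measure (Fin d → Measure Θ) :=
  vecIFPP (qStar q h K u)
    (fun j => normalized (densityLaw fun s => Real.exp (-(u j * s)) * h j s)) P₀

/-- The law of the superposition (sum) of two independent vectors of random measures. -/
def superpositionLaw {Θ : Type*} [MeasurableSpace Θ] {d : ℕ}
    (A B : Measure (Fin d → Measure Θ)) : Measure (Fin d → Measure Θ) :=
  (A.prod B).map (fun p => p.1 + p.2)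

end

/-! The posterior is found by testing the joint law of $(\theta,U,\mu)$ against an arbitrary
measurable $F\ge 0$. Given $M=m$, the weights and the atoms, each observation picks an atom, so the
law of $\theta$ is a finite sum over assignments $c$ of the observations to the $m$ atoms, the term
of $c$ carrying the factor $\prod_j T_j^{-n_j}\prod_i S_{j,c(j,i)}$. Relative to independent
Gamma$(n_j,1)$ variables, $U$ has density $\prod_j T_j^{n_j}e^{u_j}e^{-u_jT_j}$. The powers of $T_j$
cancel, and what is left is $\prod_j e^{u_j}$ times a product over pairs (group, atom) of factors
$e^{-u_js}s^{N}$, with $N$ the number of observations of the group at the atom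
(`lintegral_samplingLaw_weightedAtoms`). Such a product tilt keeps the weights independent, which is
the purpose of the variables $U_j$ (`withDensity_tiltedWeights`).

An assignment $c$ is the same as a partition $\pi$ of the observations together with an embedding of
its $K$ blocks into the $m$ atoms (`sum_array_eq_sum_partition`). By exchangeability all $m!/(m-K)!$
embeddings contribute equally. With $m=l+K$, the $l$ atoms without observations contribute
$\prod_j\psi_j(u_j)^l$, and the sum over $l$ is the unnormalized $q^*_M$ (`tsum_sum_embedding`,
`tsum_sum_array_eq`). Given $\pi$, the atoms at the blocks are i.i.d. from $P_0$ and, as $P_0$ is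
diffuse, almost surely distinct (`ae_injective_pi`). Hence $\pi$ and the atoms can be read off
$\theta$, and the conditional law depends on the data alone: this is `dataKernel`.

Testing with $F=1$ shows that the normalizing constant of $q^*_M$ is almost everywhere finite
(`ae_qStarMass_ne_top`). Data for which it is zero have probability zero, as it is a factor of their
contribution (`lintegral_samplingKernel_irregular`). -/

/-! ### Finite product measures -/

open Classical in
theorem lintegral_pi_prod_eval {ι : Type*} [Fintype ι] {X : ι → Type*} [∀ i, MeasurableSpace (X i)]
    (μ : ∀ i, Measure (X i)) [∀ i, IsProbabilityMeasure (μ i)] {f : ∀ i, X i → ℝ≥0∞}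
    (hf : ∀ i, Measurable (f i)) :
    ∫⁻ x, ∏ i, f i (x i) ∂(Measure.pi μ) = ∏ i, ∫⁻ y, f i y ∂(μ i) := by
  rw [lintegral_prod_eq_prod_lintegral_of_indepFun Finset.univ (fun i (x : ∀ i, X i) => f i (x i))
    (iIndepFun_pi fun i => (hf i).aemeasurable) (fun i => (hf i).comp (measurable_pi_apply i))]
  refine Finset.prod_congr rfl fun i _ => ?_
  rw [← (measurePreserving_eval μ i).map_eq, lintegral_map (hf i) (measurable_pi_apply i)]

/-- On a box the integral of the product density factorizes. The constants must be nonzero and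
finite because the identity is proved after division by their product. -/
theorem pi_withDensity_prod {ι : Type*} [Fintype ι] {X : ι → Type*} [∀ i, MeasurableSpace (X i)]
    (μ ν : ∀ i, Measure (X i)) [∀ i, IsProbabilityMeasure (μ i)] [∀ i, IsProbabilityMeasure (ν i)]
    {f : ∀ i, X i → ℝ≥0∞} (hf : ∀ i, Measurable (f i)) {c : ι → ℝ≥0∞} (hc0 : ∀ i, c i ≠ 0)
    (hc : ∀ i, c i ≠ ∞) (h : ∀ i, (μ i).withDensity (f i) = c i • ν i) :
    (Measure.pi μ).withDensity (fun x => ∏ i, f i (x i)) = (∏ i, c i) • Measure.pi ν := by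
  classical
  have key : (∏ i, c i)⁻¹ • (Measure.pi μ).withDensity (fun x => ∏ i, f i (x i))
      = Measure.pi ν := by
    refine (Measure.pi_eq fun s hs => ?_).symm
    have hS : MeasurableSet (Set.univ.pi s) := MeasurableSet.univ_pi hs
    have h1 : ∀ x : ∀ i, X i, (Set.univ.pi s).indicator (fun x => ∏ i, f i (x i)) x
        = ∏ i, (s i).indicator (f i) (x i) := by
      intro x
      by_cases hx : x ∈ Set.univ.pi s
      · rw [Set.indicator_of_mem hx]
        exact Finset.prod_congr rfl fun i _ => (Set.indicator_of_mem (hx i trivial) _).symm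
      · rw [Set.indicator_of_notMem hx]
        simp only [Set.mem_pi, not_forall] at hx
        obtain ⟨i, -, hi⟩ := hx
        exact (Finset.prod_eq_zero (Finset.mem_univ i) (Set.indicator_of_notMem hi _)).symm
    rw [Measure.smul_apply, withDensity_apply _ hS, ← lintegral_indicator hS, lintegral_congr h1,
      lintegral_pi_prod_eval μ fun i => (hf i).indicator (hs i)]
    have h2 : ∀ i, ∫⁻ y, (s i).indicator (f i) y ∂(μ i) = c i * ν i (s i) := by
      intro i
      rw [lintegral_indicator (hs i), ← withDensity_apply _ (hs i), h i]; rfl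
    simp_rw [h2]
    rw [Finset.prod_mul_distrib, smul_eq_mul, ← mul_assoc, ENNReal.inv_mul_cancel, one_mul]
    · exact Finset.prod_ne_zero_iff.2 fun i _ => hc0 i
    · exact ENNReal.prod_ne_top fun i _ => hc i
  rw [← key, smul_smul, ENNReal.mul_inv_cancel, one_smul]
  · exact Finset.prod_ne_zero_iff.2 fun i _ => hc0 i
  · exact ENNReal.prod_ne_top fun i _ => hc i

/-- Expanding the product of sums on a box gives one term per choice function. This turns i.i.d.
sampling from a discrete measure into a sum over assignments. -/
theorem pi_sum_smul_dirac {ι : Type*} [Fintype ι] [DecidableEq ι] {X : ι → Type*}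
    [∀ i, MeasurableSpace (X i)]
    {κ : ι → Type*} [∀ i, Fintype (κ i)] (a : ∀ i, κ i → ℝ≥0∞) (ha : ∀ i k, a i k ≠ ∞)
    (x : ∀ i, κ i → X i) :
    Measure.pi (fun i => ∑ k, a i k • Measure.dirac (x i k))
      = ∑ c : ∀ i, κ i, (∏ i, a i (c i)) • Measure.dirac (fun i => x i (c i)) := by
  have : ∀ i, IsFiniteMeasure (∑ k, a i k • Measure.dirac (x i k)) := fun i => by
    constructor
    simp [Measure.finsetSum_apply, lt_top_iff_ne_top, ha i]
  refine Measure.pi_eq fun s hs => ?_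
  simp only [Measure.finsetSum_apply, Measure.smul_apply, smul_eq_mul]
  rw [Finset.prod_univ_sum]
  simp only [Fintype.piFinset_univ]
  refine Finset.sum_congr rfl fun c _ => ?_
  rw [Finset.prod_mul_distrib, Measure.dirac_apply' _ (MeasurableSet.univ_pi hs)]
  congr 1
  simp_rw [Measure.dirac_apply' _ (hs _)]
  by_cases hx : (fun i => x i (c i)) ∈ Set.univ.pi s
  · rw [Set.indicator_of_mem hx]
    refine (Finset.prod_eq_one fun i _ => ?_).symm
    rw [Set.indicator_of_mem (hx i trivial)]; rfl
  · rw [Set.indicator_of_notMem hx]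
    simp only [Set.mem_pi, not_forall] at hx
    obtain ⟨i, -, hi⟩ := hx
    exact (Finset.prod_eq_zero (Finset.mem_univ i) (Set.indicator_of_notMem hi _)).symm

theorem measurable_measure_pi {A ι : Type*} [MeasurableSpace A] [Fintype ι] {X : ι → Type*}
    [∀ i, MeasurableSpace (X i)] {κ : A → ∀ i, Measure (X i)}
    [∀ a i, IsProbabilityMeasure (κ a i)] (h : ∀ i, Measurable fun a => κ a i) :
    Measurable fun a => Measure.pi (κ a) := by
  refine Measurable.measure_of_isPiSystem_of_isProbabilityMeasure generateFrom_pi.symm isPiSystem_pi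
    ?_
  rintro _ ⟨s, hs, rfl⟩
  simp_rw [Measure.pi_pi]
  exact Finset.measurable_fun_prod _ fun i _ => (Measure.measurable_coe (hs i trivial)).comp (h i)

/-- Two distinct coordinates have law `μ.prod μ`, and the diagonal is null for it because its
sections are singletons. This is where diffuseness enters. -/
theorem ae_injective_pi {ι X : Type*} [Fintype ι] [MeasurableSpace X] [MeasurableEq X]
    (μ : Measure X) [IsProbabilityMeasure μ] [NullSingletonClass μ] :
    ∀ᵐ x ∂(Measure.pi fun _ : ι => μ), Function.Injective x := by
  classical
  have h : ∀ a b : ι, a ≠ b → ∀ᵐ x ∂(Measure.pi fun _ : ι => μ), x a ≠ x b := by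
    intro a b hab
    have hind : IndepFun (fun x : ι → X => x a) (fun x => x b) (Measure.pi fun _ : ι => μ) :=
      (iIndepFun_pi (X := fun _ => id) fun i => aemeasurable_id).indepFun hab
    have hm : (Measure.pi fun _ : ι => μ).map (fun x => (x a, x b)) = μ.prod μ := by
      rw [(indepFun_iff_map_prod_eq_prod_map_map (measurable_pi_apply a).aemeasurable
        (measurable_pi_apply b).aemeasurable).1 hind]
      congr 1 <;> exact (measurePreserving_eval (fun _ : ι => μ) _).map_eq
    have hd : MeasurableSet {p : X × X | p.1 = p.2} := measurableSet_eq_fun measurable_fst measurable_snd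
    have : ∀ᵐ p ∂(μ.prod μ), p.1 ≠ p.2 := by
      rw [ae_iff]
      simp only [not_not]
      rw [Measure.measure_prod_null hd]
      refine Filter.Eventually.of_forall fun x => ?_
      have : Prod.mk x ⁻¹' {p : X × X | p.1 = p.2} = {x} := by ext y; simp [eq_comm]
      simp [this]
    rw [← hm] at this
    exact ae_of_ae_map ((measurable_pi_apply a).prodMk (measurable_pi_apply b)).aemeasurable this
  have h' : ∀ᵐ x ∂(Measure.pi fun _ : ι => μ), ∀ a b : ι, a ≠ b → x a ≠ x b := by
    rw [ae_all_iff]; intro a; rw [ae_all_iff]; intro b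
    by_cases hab : a = b
    · simp [hab]
    · filter_upwards [h a b hab] with x hx _ using hx
  filter_upwards [h'] with x hx a b hab
  by_contra hne
  exact hx a b hne hab

theorem pi_pi_ext {ι κ : Type*} [Fintype ι] [Fintype κ] {X : Type*} [MeasurableSpace X]
    (μ : ι → κ → Measure X) [∀ i k, IsProbabilityMeasure (μ i k)] {ν : Measure (ι → κ → X)}
    (h : ∀ s : ι → κ → Set X, (∀ i k, MeasurableSet (s i k)) →
      ν (Set.univ.pi fun i => Set.univ.pi (s i)) = ∏ i, ∏ k, μ i k (s i k)) :
    ν = Measure.pi fun i => Measure.pi (μ i) := by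
  symm
  refine Measure.pi_eq_generateFrom
    (C := fun _ => Set.pi Set.univ '' Set.pi Set.univ fun _ : κ => {s : Set X | MeasurableSet s})
    (fun i => generateFrom_pi) (fun i => isPiSystem_pi)
    (fun i => Measure.FiniteSpanningSetsIn.pi fun k => (μ i k).toFiniteSpanningSetsIn) ?_
  intro t ht
  choose s hs hst using ht
  have : t = fun i => Set.univ.pi (s i) := funext fun i => (hst i).symm
  subst this
  rw [h s fun i k => hs i k trivial]
  simp_rw [Measure.pi_pi]

/-! ### Measurability of operations on measures, product kernels and normalization -/

theorem Measurable.add_measure {A X : Type*} [MeasurableSpace A] [MeasurableSpace X]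
    {f g : A → Measure X} (hf : Measurable f) (hg : Measurable g) :
    Measurable fun a => f a + g a :=
  Measure.measurable_of_measurable_coe _ fun _ hs =>
    ((Measure.measurable_coe hs).comp hf).add ((Measure.measurable_coe hs).comp hg)

theorem Measurable.finsetSum_measure {A X ι : Type*} [MeasurableSpace A] [MeasurableSpace X]
    (t : Finset ι) {f : ι → A → Measure X} (hf : ∀ i ∈ t, Measurable (f i)) :
    Measurable fun a => ∑ i ∈ t, f i a :=
  Measure.measurable_of_measurable_coe _ fun s hs => by
    simp_rw [Measure.finsetSum_apply]
    exact Finset.measurable_fun_sum _ fun i hi => (Measure.measurable_coe hs).comp (hf i hi)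

theorem Measurable.smul_measure_measure {A X : Type*} [MeasurableSpace A] [MeasurableSpace X]
    {c : A → ℝ≥0∞} {f : A → Measure X} (hc : Measurable c) (hf : Measurable f) :
    Measurable fun a => c a • f a :=
  Measure.measurable_of_measurable_coe _ fun _ hs => hc.mul ((Measure.measurable_coe hs).comp hf)

theorem measurable_vector_add {X : Type*} [MeasurableSpace X] {d : ℕ} :
    Measurable fun p : (Fin d → Measure X) × (Fin d → Measure X) => p.1 + p.2 :=
  measurable_pi_lambda _ fun j => Measurable.add_measure
    ((measurable_pi_apply j).comp measurable_fst) ((measurable_pi_apply j).comp measurable_snd)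

theorem measurable_weightedAtoms {X ι : Type*} [MeasurableSpace X] [Fintype ι] {d : ℕ} :
    Measurable fun p : (Fin d → ι → ℝ) × (ι → X) => weightedAtoms p.1 p.2 :=
  measurable_pi_lambda _ fun j => Measurable.finsetSum_measure _ fun k _ =>
    Measurable.smul_measure_measure
      (ENNReal.measurable_ofReal.comp (by fun_prop))
      (Measure.measurable_dirac.comp (by fun_prop))

/-- The product of finitely many Markov kernels with the same source. -/
noncomputable def piKernel {A ι : Type*} [MeasurableSpace A] [Fintype ι] {X : ι → Type*}
    [∀ i, MeasurableSpace (X i)] (κ : ∀ i, Kernel A (X i)) [∀ i, IsMarkovKernel (κ i)] :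
    Kernel A (∀ i, X i) :=
  ⟨fun a => Measure.pi fun i => κ i a, measurable_measure_pi fun i => (κ i).measurable⟩

theorem piKernel_apply {A ι : Type*} [MeasurableSpace A] [Fintype ι] {X : ι → Type*}
    [∀ i, MeasurableSpace (X i)] (κ : ∀ i, Kernel A (X i)) [∀ i, IsMarkovKernel (κ i)] (a : A) :
    piKernel κ a = Measure.pi fun i => κ i a := rfl

instance {A ι : Type*} [MeasurableSpace A] [Fintype ι] {X : ι → Type*}
    [∀ i, MeasurableSpace (X i)] (κ : ∀ i, Kernel A (X i)) [∀ i, IsMarkovKernel (κ i)] :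
    IsMarkovKernel (piKernel κ) :=
  ⟨fun a => by rw [piKernel_apply]; infer_instance⟩

theorem normalized_smul_self {α : Type*} [MeasurableSpace α] {ν : Measure α}
    (h : ν Set.univ ≠ ∞) : ν Set.univ • normalized ν = ν := by
  by_cases h0 : ν Set.univ = 0
  · rw [h0, zero_smul, Measure.measure_univ_eq_zero.1 h0]
  · rw [normalized, smul_smul, ENNReal.mul_inv_cancel h0 h, one_smul]

theorem isProbabilityMeasure_normalized {α : Type*} [MeasurableSpace α] {ν : Measure α}
    (h0 : ν Set.univ ≠ 0) (h : ν Set.univ ≠ ∞) : IsProbabilityMeasure (normalized ν) :=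
  ⟨by rw [normalized, Measure.smul_apply, smul_eq_mul, ENNReal.inv_mul_cancel h0 h]⟩

theorem ae_pos_densityLaw (h : ℝ → ℝ) : ∀ᵐ s ∂(densityLaw h), 0 < s :=
  (withDensity_absolutelyContinuous _ _).ae_le (ae_restrict_mem measurableSet_Ioi)

/-! ### Tilting the law of one weight -/

/-- The factor `exp (-u s) s ^ c` by which the law of a weight is tilted. -/
noncomputable def tiltWeight (c : ℕ) (u s : ℝ) : ℝ≥0∞ :=
  ENNReal.ofReal (Real.exp (-(u * s)) * s ^ c)

@[fun_prop]
theorem measurable_tiltWeight (c : ℕ) : Measurable fun p : ℝ × ℝ => tiltWeight c p.1 p.2 := by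
  unfold tiltWeight; fun_prop

theorem Measurable.tiltWeight {A : Type*} [MeasurableSpace A] (c : ℕ) {f g : A → ℝ}
    (hf : Measurable f) (hg : Measurable g) : Measurable fun a => tiltWeight c (f a) (g a) :=
  (measurable_tiltWeight c).comp (hf.prodMk hg)

theorem measurable_tiltWeight_right (c : ℕ) (u : ℝ) : Measurable (tiltWeight c u) :=
  (measurable_tiltWeight c).comp measurable_prodMk_left

/-- The normalizing constant of the density `exp (-u s) s ^ c h(s)`. -/
noncomputable def tiltedMass (h : ℝ → ℝ) (c : ℕ) (u : ℝ) : ℝ≥0∞ :=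
  densityLaw (fun s => Real.exp (-(u * s)) * s ^ c * h s) Set.univ

/-- The law with density proportional to `exp (-u s) s ^ c h(s)`. -/
noncomputable def tiltedLaw (h : ℝ → ℝ) (c : ℕ) (u : ℝ) : Measure ℝ :=
  normalized (densityLaw fun s => Real.exp (-(u * s)) * s ^ c * h s)

section Tilt

variable {h : ℝ → ℝ} (hmeas : Measurable h)
include hmeas

theorem densityLaw_withDensity_tiltWeight (c : ℕ) (u : ℝ) :
    (densityLaw h).withDensity (tiltWeight c u)
      = densityLaw (fun s => Real.exp (-(u * s)) * s ^ c * h s) := by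
  rw [densityLaw, ← withDensity_mul _ (by fun_prop)
    (measurable_tiltWeight_right c u), densityLaw]
  refine withDensity_congr_ae ?_
  filter_upwards [ae_restrict_mem measurableSet_Ioi] with s hs
  have hs' : (0 : ℝ) < s := hs
  -- `ENNReal.ofReal` is multiplicative once the first factor is nonnegative, which holds as `s` is
  -- positive here.
  rw [Pi.mul_apply, tiltWeight, ENNReal.ofReal_mul (by positivity : 0 ≤ Real.exp (-(u * s)) * s ^ c),
    mul_comm]

theorem tiltedMass_eq_lintegral (c : ℕ) (u : ℝ) :
    tiltedMass h c u = ∫⁻ s, tiltWeight c u s ∂(densityLaw h) := by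
  rw [tiltedMass, ← densityLaw_withDensity_tiltWeight hmeas, withDensity_apply _ MeasurableSet.univ,
    setLIntegral_univ]

theorem tiltedMass_zero_eq_laplaceTransform (u : ℝ) :
    tiltedMass h 0 u = laplaceTransform h u := by
  rw [tiltedMass_eq_lintegral hmeas, laplaceTransform]
  simp [tiltWeight]

theorem measurable_densityLaw_tilt (c : ℕ) :
    Measurable fun u => densityLaw (fun s => Real.exp (-(u * s)) * s ^ c * h s) := by
  have : SFinite (densityLaw h) := by unfold densityLaw; infer_instance
  refine Measure.measurable_of_measurable_coe _ fun B hB => ?_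
  simp_rw [← densityLaw_withDensity_tiltWeight hmeas, withDensity_apply _ hB]
  exact Measurable.lintegral_prod_right' (f := fun p : ℝ × ℝ => tiltWeight c p.1 p.2)
    (measurable_tiltWeight c)

theorem measurable_tiltedMass (c : ℕ) : Measurable fun u => tiltedMass h c u :=
  (Measure.measurable_coe MeasurableSet.univ).comp (measurable_densityLaw_tilt hmeas c)

variable [IsProbabilityMeasure (densityLaw h)]

theorem tiltedMass_ne_zero (c : ℕ) (u : ℝ) : tiltedMass h c u ≠ 0 := by
  rw [tiltedMass_eq_lintegral hmeas]
  intro h0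
  rw [lintegral_eq_zero_iff (measurable_tiltWeight_right c u)] at h0
  obtain ⟨s, hs, hs'⟩ := (h0.and (ae_pos_densityLaw h)).exists
  have : 0 < Real.exp (-(u * s)) * s ^ c := by positivity
  simp only [tiltWeight, Pi.zero_apply, ENNReal.ofReal_eq_zero] at hs
  linarith

/-- The exponential series gives $(us)^c/c!\le e^{us}$, so the tilting factor is bounded by
$c!/u^c$, a constant integrable against a probability measure. -/
theorem tiltedMass_ne_top (c : ℕ) {u : ℝ} (hu : 0 < u) : tiltedMass h c u ≠ ∞ := by
  rw [tiltedMass_eq_lintegral hmeas]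
  have hb : ∀ᵐ s ∂(densityLaw h), tiltWeight c u s ≤ ENNReal.ofReal (c ! / u ^ c) := by
    filter_upwards [ae_pos_densityLaw h] with s hs
    refine ENNReal.ofReal_le_ofReal ?_
    have h1 := Real.pow_div_factorial_le_exp (u * s) (by positivity) c
    rw [Real.exp_neg, ← div_eq_inv_mul, div_le_div_iff₀ (Real.exp_pos _) (by positivity)]
    rw [div_le_iff₀ (by positivity), mul_pow] at h1
    linarith
  refine ne_top_of_le_ne_top ?_ (lintegral_mono_ae hb)
  simp

theorem isProbabilityMeasure_tiltedLaw (c : ℕ) {u : ℝ} (hu : 0 < u) :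
    IsProbabilityMeasure (tiltedLaw h c u) :=
  isProbabilityMeasure_normalized (tiltedMass_ne_zero hmeas c u) (tiltedMass_ne_top hmeas c hu)

end Tilt

/-! ### Vectors of tilted weights and atoms, and their splitting along a bijection of indices -/

section Vector

variable {d : ℕ} {κ κ' κ'' : Type*} [Fintype κ] [Fintype κ'] [Fintype κ'']

/-- The joint law of independent weights, the `(j, k)`-th of which has density proportional to
`exp (-u_j s) s ^ N_{j,k} h_j(s)`. -/
noncomputable def tiltedWeights (h : Fin d → ℝ → ℝ) (N : Fin d → κ → ℕ) (u : Fin d → ℝ) :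
    Measure (Fin d → κ → ℝ) :=
  Measure.pi fun j => Measure.pi fun k => tiltedLaw (h j) (N j k) (u j)

/-- The product of the normalizing constants of the laws in `tiltedWeights`. -/
noncomputable def tiltedWeightsMass (h : Fin d → ℝ → ℝ) (N : Fin d → κ → ℕ) (u : Fin d → ℝ) :
    ℝ≥0∞ :=
  ∏ j, ∏ k, tiltedMass (h j) (N j k) (u j)

variable {h : Fin d → ℝ → ℝ} (hmeas : ∀ j, Measurable (h j))
include hmeas

theorem measurable_tiltedWeightsMass (N : Fin d → κ → ℕ) :
    Measurable fun u => tiltedWeightsMass h N u :=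
  Finset.measurable_fun_prod _ fun j _ => Finset.measurable_fun_prod _ fun _ _ =>
    (measurable_tiltedMass (hmeas j) _).comp (measurable_pi_apply j)

variable (hprob : ∀ j, IsProbabilityMeasure (densityLaw (h j)))
include hprob

theorem tiltedWeightsMass_ne_zero (N : Fin d → κ → ℕ) (u : Fin d → ℝ) :
    tiltedWeightsMass h N u ≠ 0 :=
  Finset.prod_ne_zero_iff.2 fun j _ => Finset.prod_ne_zero_iff.2 fun _ _ =>
    tiltedMass_ne_zero (hmeas j) _ _

variable {u : Fin d → ℝ} (hu : ∀ j, 0 < u j)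
include hu

theorem isProbabilityMeasure_tiltedWeights (N : Fin d → κ → ℕ) :
    IsProbabilityMeasure (tiltedWeights h N u) := by
  have := fun j k => isProbabilityMeasure_tiltedLaw (hmeas j) (N j k) (hu j)
  unfold tiltedWeights; infer_instance

/-- The tilt is a product over groups and atoms, so `pi_withDensity_prod`, used once for each of the
two nested products, preserves independence. -/
theorem withDensity_tiltedWeights (N : Fin d → κ → ℕ) :
    (Measure.pi fun j => Measure.pi fun _ : κ => densityLaw (h j)).withDensity
        (fun s => ∏ j, ∏ k, tiltWeight (N j k) (u j) (s j k))
      = tiltedWeightsMass h N u • tiltedWeights h N u := by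
  have := fun j k => isProbabilityMeasure_tiltedLaw (hmeas j) (N j k) (hu j)
  refine pi_withDensity_prod _ _ (f := fun j (s : κ → ℝ) => ∏ k, tiltWeight (N j k) (u j) (s k))
    (fun j => Finset.measurable_fun_prod _ fun k _ =>
      measurable_const.tiltWeight _ (measurable_pi_apply k))
    (fun j => Finset.prod_ne_zero_iff.2 fun k _ => tiltedMass_ne_zero (hmeas j) _ _)
    (fun j => ENNReal.prod_ne_top fun k _ => tiltedMass_ne_top (hmeas j) _ (hu j)) fun j => ?_
  refine pi_withDensity_prod _ _ (f := fun k => tiltWeight (N j k) (u j))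
    (fun k => measurable_const.tiltWeight _ measurable_id)
    (fun k => tiltedMass_ne_zero (hmeas j) _ _)
    (fun k => tiltedMass_ne_top (hmeas j) _ (hu j)) fun k => ?_
  rw [densityLaw_withDensity_tiltWeight (hmeas j)]
  exact (normalized_smul_self (tiltedMass_ne_top (hmeas j) _ (hu j))).symm

theorem tiltedWeights_map_equiv (σ : κ' ≃ κ) (N : Fin d → κ → ℕ) :
    (tiltedWeights h (fun j k => N j (σ k)) u).map (fun s j k => s j (σ.symm k))
      = tiltedWeights h N u := by
  have := fun j k => isProbabilityMeasure_tiltedLaw (hmeas j) (N j k) (hu j)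
  refine pi_pi_ext _ fun t ht => ?_
  rw [Measure.map_apply (by fun_prop)
    (MeasurableSet.univ_pi fun j => MeasurableSet.univ_pi fun k => ht j k)]
  have : (fun (s : Fin d → κ' → ℝ) j k => s j (σ.symm k)) ⁻¹'
      (Set.univ.pi fun j => Set.univ.pi (t j))
      = Set.univ.pi fun j => Set.univ.pi fun k => t j (σ k) := by
    ext s
    simp [Set.mem_pi, σ.symm.forall_congr_left]
  rw [this, tiltedWeights]
  simp_rw [Measure.pi_pi]
  exact Finset.prod_congr rfl fun j _ =>
    σ.prod_comp fun k => tiltedLaw (h j) (N j k) (u j) (t j k)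

theorem tiltedWeights_prod_map_sumEquiv (σ : κ ⊕ κ' ≃ κ'') (N : Fin d → κ'' → ℕ) :
    ((tiltedWeights h (fun j k => N j (σ (.inl k))) u).prod
      (tiltedWeights h (fun j k => N j (σ (.inr k))) u)).map
        (fun p j k => Sum.elim (p.1 j) (p.2 j) (σ.symm k)) = tiltedWeights h N u := by
  have hp := fun j k => isProbabilityMeasure_tiltedLaw (hmeas j) (N j k) (hu j)
  refine pi_pi_ext _ fun t ht => ?_
  rw [Measure.map_apply _ (MeasurableSet.univ_pi fun j => MeasurableSet.univ_pi fun k => ht j k)]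
  · have : (fun (p : (Fin d → κ → ℝ) × (Fin d → κ' → ℝ)) j k =>
          Sum.elim (p.1 j) (p.2 j) (σ.symm k)) ⁻¹' (Set.univ.pi fun j => Set.univ.pi (t j))
        = (Set.univ.pi fun j => Set.univ.pi fun k => t j (σ (.inl k))) ×ˢ
          (Set.univ.pi fun j => Set.univ.pi fun k => t j (σ (.inr k))) := by
      ext p
      simp [Set.mem_pi, ← forall_and, σ.symm.forall_congr_left]
    have h1 := isProbabilityMeasure_tiltedWeights hmeas hprob hu (fun j k => N j (σ (.inr k)))
    rw [this, Measure.prod_prod]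
    simp only [tiltedWeights, Measure.pi_pi, ← Finset.prod_mul_distrib]
    refine Finset.prod_congr rfl fun j _ => ?_
    rw [← σ.prod_comp, Fintype.prod_sum_type]
  · refine measurable_pi_lambda _ fun j => measurable_pi_lambda _ fun k => ?_
    cases σ.symm k <;> simp only [Sum.elim_inl, Sum.elim_inr] <;> fun_prop

end Vector

theorem measurable_sumElim_equiv {κ κ' κ'' X : Type*} [MeasurableSpace X] (σ : κ ⊕ κ' ≃ κ'') :
    Measurable fun (p : (κ → X) × (κ' → X)) k => Sum.elim p.1 p.2 (σ.symm k) := by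
  refine measurable_pi_lambda _ fun k => ?_
  cases σ.symm k <;> simp only [Sum.elim_inl, Sum.elim_inr] <;> fun_prop

theorem pi_const_prod_map_sumEquiv {κ κ' κ'' X : Type*} [Fintype κ] [Fintype κ'] [Fintype κ'']
    [MeasurableSpace X] (μ : Measure X) [IsProbabilityMeasure μ] (σ : κ ⊕ κ' ≃ κ'') :
    ((Measure.pi fun _ : κ => μ).prod (Measure.pi fun _ : κ' => μ)).map
      (fun p k => Sum.elim p.1 p.2 (σ.symm k)) = Measure.pi fun _ : κ'' => μ := by
  refine (Measure.pi_eq fun t ht => ?_).symm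
  rw [Measure.map_apply (measurable_sumElim_equiv σ) (MeasurableSet.univ_pi ht)]
  have : (fun (p : (κ → X) × (κ' → X)) k => Sum.elim p.1 p.2 (σ.symm k)) ⁻¹' (Set.univ.pi t)
      = (Set.univ.pi fun k => t (σ (.inl k))) ×ˢ (Set.univ.pi fun k => t (σ (.inr k))) := by
    ext p
    simp [Set.mem_pi, σ.symm.forall_congr_left]
  rw [this, Measure.prod_prod]
  simp only [Measure.pi_pi]
  rw [← σ.prod_comp, Fintype.prod_sum_type]

theorem weightedAtoms_sumEquiv {Θ κ κ' κ'' : Type*} [MeasurableSpace Θ] [Fintype κ] [Fintype κ']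
    [Fintype κ''] {d : ℕ} (σ : κ ⊕ κ' ≃ κ'') (s : Fin d → κ → ℝ) (s' : Fin d → κ' → ℝ)
    (x : κ → Θ) (y : κ' → Θ) :
    weightedAtoms (fun j k => Sum.elim (s j) (s' j) (σ.symm k))
      (fun k => Sum.elim x y (σ.symm k)) = weightedAtoms s x + weightedAtoms s' y := by
  funext j
  simp only [weightedAtoms, Pi.add_apply]
  rw [← σ.sum_comp, Fintype.sum_sum_type]
  simp

section

variable {Θ : Type*} [MeasurableSpace Θ] (P₀ : Measure Θ) [IsProbabilityMeasure P₀]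
  {d : ℕ} {κ κ' κ'' : Type*} [Fintype κ] [Fintype κ'] [Fintype κ'']
  {h : Fin d → ℝ → ℝ} (hmeas : ∀ j, Measurable (h j))
  (hprob : ∀ j, IsProbabilityMeasure (densityLaw (h j)))
  {u : Fin d → ℝ} (hu : ∀ j, 0 < u j)

/-- The law of independent weights and atoms: the weights have the law `tiltedWeights h N u`, and
the atoms are sampled from `P₀`. -/
noncomputable def markedAtoms (h : Fin d → ℝ → ℝ) (N : Fin d → κ → ℕ) (u : Fin d → ℝ) :
    Measure ((Fin d → κ → ℝ) × (κ → Θ)) :=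
  (tiltedWeights h N u).prod (Measure.pi fun _ => P₀)

include hmeas hprob hu

theorem isProbabilityMeasure_markedAtoms (N : Fin d → κ → ℕ) :
    IsProbabilityMeasure (markedAtoms P₀ h N u) := by
  have := isProbabilityMeasure_tiltedWeights hmeas hprob hu N
  unfold markedAtoms; infer_instance

/-- Independence lets the marked atoms be drawn in two batches. The left summand of `σ` will index
the atoms carrying observations, the right summand the others, and the vector of measures is the sum
of the two contributions. -/
theorem lintegral_markedAtoms_sumEquiv (σ : κ ⊕ κ' ≃ κ'') (N : Fin d → κ'' → ℕ)
    {F : (κ → Θ) × (Fin d → Measure Θ) → ℝ≥0∞} (hF : Measurable F) :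
    ∫⁻ p, F (fun k => p.2 (σ (.inl k)), weightedAtoms p.1 p.2) ∂(markedAtoms P₀ h N u)
      = ∫⁻ a, ∫⁻ b, F (a.2, weightedAtoms a.1 a.2 + weightedAtoms b.1 b.2)
          ∂(markedAtoms P₀ h (fun j k => N j (σ (.inr k))) u)
          ∂(markedAtoms P₀ h (fun j k => N j (σ (.inl k))) u) := by
  have h0 := isProbabilityMeasure_tiltedWeights hmeas hprob hu N
  have h1 := isProbabilityMeasure_tiltedWeights hmeas hprob hu (fun j k => N j (σ (.inl k)))
  have h2 := isProbabilityMeasure_tiltedWeights hmeas hprob hu (fun j k => N j (σ (.inr k)))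
  have hG : Measurable fun q : ((Fin d → κ → ℝ) × (κ → Θ)) × ((Fin d → κ' → ℝ) × (κ' → Θ)) =>
      F (q.1.2, weightedAtoms q.1.1 q.1.2 + weightedAtoms q.2.1 q.2.2) :=
    hF.comp ((measurable_snd.comp measurable_fst).prodMk (measurable_vector_add.comp
      ((measurable_weightedAtoms.comp measurable_fst).prodMk
        (measurable_weightedAtoms.comp measurable_snd))))
  have hL : Measurable fun p : (Fin d → κ'' → ℝ) × (κ'' → Θ) =>
      F (fun k => p.2 (σ (.inl k)), weightedAtoms p.1 p.2) :=
    hF.comp (Measurable.prodMk (by fun_prop) measurable_weightedAtoms)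
  have hσ : Measurable fun (p : (Fin d → κ → ℝ) × (Fin d → κ' → ℝ)) j k =>
      Sum.elim (p.1 j) (p.2 j) (σ.symm k) := by
    refine measurable_pi_lambda _ fun j => (measurable_sumElim_equiv σ).comp
      (show Measurable fun p : (Fin d → κ → ℝ) × (Fin d → κ' → ℝ) => (p.1 j, p.2 j) by fun_prop)
  unfold markedAtoms
  rw [lintegral_prod _ hL.aemeasurable, ← tiltedWeights_prod_map_sumEquiv hmeas hprob hu σ N,
    lintegral_map hL.lintegral_prod_right' hσ, ← pi_const_prod_map_sumEquiv P₀ σ]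
  have hτ := fun s : Fin d → κ'' → ℝ => lintegral_map
    (μ := (Measure.pi fun _ : κ => P₀).prod (Measure.pi fun _ : κ' => P₀))
    (hL.comp (measurable_prodMk_left (x := s))) (measurable_sumElim_equiv σ)
  simp only [Function.comp_def] at hτ
  simp_rw [hτ]
  simp only [Equiv.symm_apply_apply, Sum.elim_inl, weightedAtoms_sumEquiv]
  have hM : Measurable fun q : ((Fin d → κ → ℝ) × (Fin d → κ' → ℝ)) × ((κ → Θ) × (κ' → Θ)) =>
      F (q.2.1, weightedAtoms q.1.1 q.2.1 + weightedAtoms q.1.2 q.2.2) :=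
    hG.comp (show Measurable fun q : ((Fin d → κ → ℝ) × (Fin d → κ' → ℝ)) × ((κ → Θ) × (κ' → Θ)) =>
      ((q.1.1, q.2.1), (q.1.2, q.2.2)) by fun_prop)
  rw [lintegral_prod _ hM.lintegral_prod_right'.aemeasurable,
    lintegral_prod _ hG.lintegral_prod_right'.aemeasurable]
  refine lintegral_congr fun s => ?_
  have hM1 : Measurable fun q : (Fin d → κ' → ℝ) × ((κ → Θ) × (κ' → Θ)) =>
      F (q.2.1, weightedAtoms s q.2.1 + weightedAtoms q.1 q.2.2) :=
    hM.comp (show Measurable fun q : (Fin d → κ' → ℝ) × ((κ → Θ) × (κ' → Θ)) =>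
      ((s, q.1), q.2) by fun_prop)
  have hG1 : ∀ x, Measurable fun q : (Fin d → κ' → ℝ) × (κ' → Θ) =>
      F (x, weightedAtoms s x + weightedAtoms q.1 q.2) := fun x =>
    hM1.comp (show Measurable fun q : (Fin d → κ' → ℝ) × (κ' → Θ) => (q.1, (x, q.2)) by fun_prop)
  have hl := fun s' : Fin d → κ' → ℝ => lintegral_prod
    (μ := Measure.pi fun _ : κ => P₀) (ν := Measure.pi fun _ : κ' => P₀) _
    (hM1.comp (measurable_prodMk_left (x := s'))).aemeasurable
  have hr := fun x : κ → Θ => lintegral_prod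
    (μ := tiltedWeights h (fun j k => N j (σ (.inr k))) u) (ν := Measure.pi fun _ : κ' => P₀) _
    (hG1 x).aemeasurable
  simp only [Function.comp_def] at hl
  simp_rw [hl, hr]
  -- The remaining difference is the order of the first batch of atoms and the second batch of
  -- weights.
  refine lintegral_lintegral_swap ?_
  exact (Measurable.lintegral_prod_right' (f := fun q : ((Fin d → κ' → ℝ) × (κ → Θ)) × (κ' → Θ) =>
    F (q.1.2, weightedAtoms s q.1.2 + weightedAtoms q.1.1 q.2))
      (hM1.comp (show Measurable fun q : ((Fin d → κ' → ℝ) × (κ → Θ)) × (κ' → Θ) =>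
        (q.1.1, (q.1.2, q.2)) by fun_prop))).aemeasurable

-- Each atom without observations contributes $\prod_j\psi_j(u_j)$, the tilted mass for the exponent
-- zero.
omit hprob hu in
theorem tiltedWeightsMass_sumEquiv (σ : κ ⊕ κ' ≃ κ'') (N : Fin d → κ'' → ℕ)
    (u : Fin d → ℝ)
    (hN : ∀ j k, N j (σ (.inr k)) = 0) :
    tiltedWeightsMass h N u = tiltedWeightsMass h (fun j k => N j (σ (.inl k))) u
      * ∏ j, laplaceTransform (h j) (u j) ^ Fintype.card κ' := by
  simp only [tiltedWeightsMass, ← Finset.prod_mul_distrib]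
  refine Finset.prod_congr rfl fun j _ => ?_
  rw [← σ.prod_comp, Fintype.prod_sum_type]
  simp [hN, tiltedMass_zero_eq_laplaceTransform (hmeas j)]

end

/-! ### Combinatorics of assignments, partitions and embeddings -/

theorem groupCount_comp {α β : Type*} {d : ℕ} {n : Fin d → ℕ} (c : (j : Fin d) → Fin (n j) → α)
    {f : α → β} (hf : Function.Injective f) (j : Fin d) (k : α) :
    groupCount (fun j i => f (c j i)) j (f k) = groupCount c j k := by
  simp only [groupCount]
  congr 1
  ext i
  simp [hf.eq_iff]

theorem groupCount_eq_zero {α : Type*} {d : ℕ} {n : Fin d → ℕ} {c : (j : Fin d) → Fin (n j) → α}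
    {j : Fin d} {k : α} (h : ∀ i, c j i ≠ k) : groupCount c j k = 0 := by
  classical
  rw [groupCount, Finset.card_eq_zero, Finset.filter_eq_empty_iff]
  exact fun i _ => h i

theorem exists_sumEquiv_extend {Q : Type*} [Fintype Q] {l : ℕ} (e : Q ↪ Fin (l + Fintype.card Q)) :
    ∃ σ : Q ⊕ Fin l ≃ Fin (l + Fintype.card Q), ∀ b, σ (.inl b) = e b := by
  classical
  have hc : Fintype.card ((Set.range e)ᶜ : Set _) = l := by
    rw [Fintype.card_compl_set, Set.card_range_of_injective e.injective, Fintype.card_fin]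
    omega
  exact ⟨((Equiv.ofInjective e e.injective).sumCongr (Fintype.equivFinOfCardEq hc).symm).trans
    (Equiv.Set.sumCompl (Set.range e)), fun b => rfl⟩

/-- There are $(l+K)!/l!$ embeddings of $K$ blocks into $l+K$ atoms, and none into fewer than $K$.
This is the source of the factorial ratio in $q^*_M$. -/
theorem tsum_sum_embedding {Q : Type*} [Fintype Q] [∀ m, Fintype (Q ↪ Fin m)] (a : ℕ → ℝ≥0∞)
    (T : ∀ m, (Q ↪ Fin m) → ℝ≥0∞) (t : ℕ → ℝ≥0∞)
    (hT : ∀ l (e : Q ↪ Fin (l + Fintype.card Q)), T _ e = t l) :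
    ∑' m, a m * ∑ e, T m e = ∑' l, a (l + Fintype.card Q)
      * (((l + Fintype.card Q) ! : ℝ≥0∞) / (l ! : ℝ≥0∞)) * t l := by
  classical
  have hsupp : Function.support (fun m => a m * ∑ e, T m e)
      ⊆ Set.range (fun l => l + Fintype.card Q) := by
    intro m hm
    by_contra hlt
    have hlt' : m < Fintype.card Q := by
      by_contra hge
      exact hlt ⟨m - Fintype.card Q, by simp only; omega⟩
    have : IsEmpty (Q ↪ Fin m) := ⟨fun e => by
      have := Fintype.card_le_of_embedding e
      simp only [Fintype.card_fin] at this
      omega⟩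
    exact hm (by simp)
  rw [← (add_left_injective (Fintype.card Q)).tsum_eq hsupp]
  refine tsum_congr fun l => ?_
  simp_rw [hT]
  rw [Finset.sum_const, Finset.card_univ, nsmul_eq_mul, ← mul_assoc]
  congr 2
  have h1 := Nat.factorial_mul_descFactorial (Nat.le_add_left (Fintype.card Q) l)
  rw [Nat.add_sub_cancel] at h1
  have h2 : Fintype.card (Q ↪ Fin (l + Fintype.card Q))
      = (l + Fintype.card Q).descFactorial (Fintype.card Q) := by
    rw [Fintype.card_eq.2 ⟨Equiv.refl _⟩, Fintype.card_embedding_eq, Fintype.card_fin]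
  rw [h2, ← h1, Nat.cast_mul, mul_comm, ENNReal.mul_div_cancel_right]
  · exact_mod_cast l.factorial_ne_zero
  · exact ENNReal.natCast_ne_top _

instance Setoid.instFinite {α : Type*} [Finite α] : Finite (Setoid α) :=
  Finite.of_injective (fun π : Setoid α => π.r) fun π π' h => Setoid.ext fun a b => by
    exact iff_of_eq (congrFun (congrFun h a) b)

noncomputable instance Setoid.instFintype {α : Type*} [Finite α] : Fintype (Setoid α) :=
  Fintype.ofFinite _

/-- The indices of the observations. -/
abbrev ObsIndex {d : ℕ} (n : Fin d → ℕ) : Type := (j : Fin d) × Fin (n j)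

/-- The array of the blocks of the observations. -/
def blockArray {d : ℕ} {n : Fin d → ℕ} (π : Setoid (ObsIndex n)) (j : Fin d) (i : Fin (n j)) :
    Quotient π := Quotient.mk π ⟨j, i⟩

-- Every array factors through the quotient by its kernel, by a unique injection; kernel and
-- injection determine the array.
open Classical in
theorem sum_array_eq_sum_partition {d : ℕ} {n : Fin d → ℕ} {β : Type*} [Fintype β]
    (g : ((j : Fin d) → Fin (n j) → β) → ℝ≥0∞) :
    ∑ c, g c = ∑ π : Setoid (ObsIndex n), ∑ e : Quotient π ↪ β,
      g (fun j i => e (blockArray π j i)) := by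
  rw [← Fintype.sum_sigma']
  symm
  refine Function.Bijective.sum_comp
    (e := fun (p : Σ π : Setoid (ObsIndex n), Quotient π ↪ β) j i => p.2 (blockArray p.1 j i))
    ⟨?_, ?_⟩ g
  · rintro ⟨π, e⟩ ⟨π', e'⟩ h
    have h' : ∀ a : ObsIndex n, e (Quotient.mk π a) = e' (Quotient.mk π' a) := fun a =>
      congrFun (congrFun h a.1) a.2
    have hπ : π = π' := by
      refine Setoid.ext fun a b => ?_
      rw [← Quotient.eq (r := π), ← Quotient.eq (r := π'), ← e.injective.eq_iff, h', h',
        e'.injective.eq_iff]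
    subst hπ
    congr 1
    ext b
    induction b using Quotient.inductionOn with
    | h a => exact h' a
  · intro c
    refine ⟨⟨Setoid.ker fun a : ObsIndex n => c a.1 a.2,
      ⟨Setoid.kerLift _, Setoid.kerLift_injective _⟩⟩, ?_⟩
    rfl

section

open Classical

variable {Θ : Type*} [MeasurableSpace Θ] (P₀ : Measure Θ) [IsProbabilityMeasure P₀]
  {d : ℕ} {n : Fin d → ℕ} {h : Fin d → ℝ → ℝ} (hmeas : ∀ j, Measurable (h j))
  (hprob : ∀ j, IsProbabilityMeasure (densityLaw (h j)))
  {u : Fin d → ℝ} (hu : ∀ j, 0 < u j)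

/-- The integral of `F` against the array `θ` with partition `π` and the sum of the allocated
component and of `l` non-allocated atoms. -/
noncomputable def partitionIntegral (h : Fin d → ℝ → ℝ) (u : Fin d → ℝ)
    (F : ((j : Fin d) → Fin (n j) → Θ) × (Fin d → Measure Θ) → ℝ≥0∞) (π : Setoid (ObsIndex n))
    (l : ℕ) : ℝ≥0∞ :=
  ∫⁻ a, ∫⁻ b, F (fun j i => a.2 (blockArray π j i), weightedAtoms a.1 a.2 + weightedAtoms b.1 b.2)
    ∂(markedAtoms P₀ h (fun _ (_ : Fin l) => 0) u)
    ∂(markedAtoms P₀ h (groupCount (blockArray π)) u)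

include hmeas hprob hu

/-- For a fixed partition, each embedding of the blocks extends to a bijection that enumerates the
unused atoms as well. Splitting along it gives a value that does not depend on the embedding, so
only the number of embeddings matters. -/
theorem tsum_sum_array_eq (q : Measure ℕ)
    {F : ((j : Fin d) → Fin (n j) → Θ) × (Fin d → Measure Θ) → ℝ≥0∞} (hF : Measurable F) :
    ∑' m, q {m} * ∑ c : (j : Fin d) → Fin (n j) → Fin m, tiltedWeightsMass h (groupCount c) u *
        ∫⁻ p, F (fun j i => p.2 (c j i), weightedAtoms p.1 p.2)
          ∂(markedAtoms P₀ h (groupCount c) u)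
      = ∑ π : Setoid (ObsIndex n), tiltedWeightsMass h (groupCount (blockArray π)) u *
          ∑' l, q {l + Fintype.card (Quotient π)}
            * (((l + Fintype.card (Quotient π)) ! : ℝ≥0∞) / (l ! : ℝ≥0∞))
            * (∏ j, laplaceTransform (h j) (u j) ^ l) * partitionIntegral P₀ h u F π l := by
  simp_rw [sum_array_eq_sum_partition, Finset.mul_sum]
  rw [Summable.tsum_finsetSum fun _ _ => ENNReal.summable]
  refine Finset.sum_congr rfl fun π _ => ?_
  simp_rw [← Finset.mul_sum]
  rw [tsum_sum_embedding (fun m => q {m}) _ (fun l =>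
    tiltedWeightsMass h (groupCount (blockArray π)) u * ((∏ j, laplaceTransform (h j) (u j) ^ l)
      * partitionIntegral P₀ h u F π l)), ← ENNReal.tsum_mul_left]
  · exact tsum_congr fun l => by ring
  intro l e
  obtain ⟨σ, hσ⟩ := exists_sumEquiv_extend e
  have hN : ∀ j b, groupCount (fun j i => σ (.inl (blockArray π j i))) j (σ (.inl b))
      = groupCount (blockArray π) j b := fun j b =>
    groupCount_comp _ (σ.injective.comp Sum.inl_injective) j b
  have hN0 : ∀ j b, groupCount (fun j i => σ (.inl (blockArray π j i))) j (σ (.inr b)) = 0 :=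
    fun j b => groupCount_eq_zero fun i h => by simpa using σ.injective h
  simp_rw [← hσ]
  rw [tiltedWeightsMass_sumEquiv hmeas σ _ u hN0, mul_assoc,
    lintegral_markedAtoms_sumEquiv P₀ hmeas hprob hu σ
      (groupCount fun j i => σ (.inl (blockArray π j i)))
      (F := fun p => F (fun j i => p.1 (blockArray π j i), p.2))
      (hF.comp (Measurable.prodMk (by fun_prop) measurable_snd))]
  simp_rw [hN, hN0, Fintype.card_fin]
  rfl

end

/-! ### Gamma variables and the cancellation of the total masses -/

theorem prod_tiltWeight_groupCount {κ : Type*} [Fintype κ] {d : ℕ} {n : Fin d → ℕ}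
    (c : (j : Fin d) → Fin (n j) → κ) (j : Fin d) (u : ℝ) {s : κ → ℝ} (hs : ∀ k, 0 < s k) :
    ∏ k, tiltWeight (groupCount c j k) u (s k)
      = ENNReal.ofReal (Real.exp (-(u * ∑ k, s k))) * ∏ i, ENNReal.ofReal (s (c j i)) := by
  classical
  have h1 : ∏ i, ENNReal.ofReal (s (c j i)) = ∏ k, ENNReal.ofReal (s k) ^ groupCount c j k := by
    rw [← Finset.prod_fiberwise' Finset.univ (c j) (fun k => ENNReal.ofReal (s k))]
    refine Finset.prod_congr rfl fun k _ => ?_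
    rw [Finset.prod_const, groupCount]
  have h2 : ENNReal.ofReal (Real.exp (-(u * ∑ k, s k)))
      = ∏ k, ENNReal.ofReal (Real.exp (-(u * s k))) := by
    rw [← ENNReal.ofReal_prod_of_nonneg fun _ _ => (Real.exp_pos _).le, ← Real.exp_sum,
      Finset.mul_sum, Finset.sum_neg_distrib]
  rw [h1, h2, ← Finset.prod_mul_distrib]
  refine Finset.prod_congr rfl fun k _ => ?_
  rw [tiltWeight, ENNReal.ofReal_mul (Real.exp_pos _).le, ENNReal.ofReal_pow (hs k).le]

/-- The rate-one law serves as a reference measure that does not depend on the random measures, so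
that the integral over $u$ can later be moved outside. -/
theorem gammaMeasure_eq_withDensity (a : ℕ) {r : ℝ} (hr : 0 < r) :
    (gammaMeasure a 1).withDensity (fun u => ENNReal.ofReal (r ^ a) *
      (ENNReal.ofReal (Real.exp u) * ENNReal.ofReal (Real.exp (-(u * r))))) = gammaMeasure a r := by
  rw [gammaMeasure, gammaMeasure, ← withDensity_mul _ (by unfold gammaPDF; fun_prop) (by fun_prop)]
  congr 1
  funext x
  rw [Pi.mul_apply]
  rcases lt_or_ge x 0 with hx | hx
  · rw [gammaPDF_of_neg hx, gammaPDF_of_neg hx, zero_mul]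
  · rw [gammaPDF_of_nonneg hx, gammaPDF_of_nonneg hx, ← ENNReal.ofReal_mul (Real.exp_pos _).le,
      ← ENNReal.ofReal_mul (by positivity), mul_comm, ← ENNReal.ofReal_mul (by positivity),
      ← Real.exp_add, Real.one_rpow, Real.rpow_natCast]
    congr 1
    have : Real.exp (-(r * x)) = Real.exp (x + -(x * r)) * Real.exp (-(1 * x)) := by
      rw [← Real.exp_add]; congr 1; ring
    rw [this]; ring

theorem ae_pos_gammaMeasure (a r : ℝ) : ∀ᵐ u ∂(gammaMeasure a r), 0 < u := by
  rw [gammaMeasure, ae_withDensity_iff (by unfold gammaPDF; fun_prop)]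
  -- The density need not vanish at the origin (for shape one it does not), so that point is
  -- discarded as a Lebesgue null set.
  filter_upwards [Measure.ae_ne volume (0 : ℝ)] with u hu h
  rcases lt_or_ge u 0 with hx | hx
  · exact absurd (gammaPDF_of_neg hx) h
  · exact lt_of_le_of_ne hx hu.symm

/-- The law of independent `Gamma(n_j, 1)` variables. -/
noncomputable def gammaVector {d : ℕ} (n : Fin d → ℕ) : Measure (Fin d → ℝ) :=
  Measure.pi fun j => gammaMeasure (n j) 1

section

variable {d : ℕ} {n : Fin d → ℕ} (hn : ∀ j, 0 < n j)
include hn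

theorem isProbabilityMeasure_gammaVector : IsProbabilityMeasure (gammaVector n) := by
  have := fun j => isProbabilityMeasure_gammaMeasure (a := n j) (r := 1)
    (by exact_mod_cast hn j) one_pos
  unfold gammaVector; infer_instance

theorem ae_pos_gammaVector : ∀ᵐ u ∂(gammaVector n), ∀ j, 0 < u j := by
  have := fun j => isProbabilityMeasure_gammaMeasure (a := n j) (r := 1)
    (by exact_mod_cast hn j) one_pos
  rw [ae_all_iff]
  exact fun j => (Measure.tendsto_eval_ae_ae (μ := fun j => gammaMeasure (n j) 1) (i := j)).eventually
    (ae_pos_gammaMeasure _ _)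

theorem pi_gammaMeasure_eq_withDensity {T : Fin d → ℝ} (hT : ∀ j, 0 < T j) :
    Measure.pi (fun j => gammaMeasure (n j) (T j)) = (gammaVector n).withDensity (fun u =>
      ∏ j, ENNReal.ofReal (T j ^ n j) *
        (ENNReal.ofReal (Real.exp (u j)) * ENNReal.ofReal (Real.exp (-(u j * T j))))) := by
  have := fun j => isProbabilityMeasure_gammaMeasure (a := n j) (r := 1)
    (by exact_mod_cast hn j) one_pos
  have := fun j => isProbabilityMeasure_gammaMeasure (a := n j) (r := T j)
    (by exact_mod_cast hn j) (hT j)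
  rw [gammaVector, pi_withDensity_prod (fun j => gammaMeasure (n j) 1)
    (fun j => gammaMeasure (n j) (T j)) (c := fun _ => 1) (f := fun j u => ENNReal.ofReal (T j ^ n j) *
        (ENNReal.ofReal (Real.exp u) * ENNReal.ofReal (Real.exp (-(u * T j))))) (fun j => by fun_prop)
    (by simp) (by simp) (fun j => by rw [gammaMeasure_eq_withDensity _ (hT j), one_smul])]
  simp

end

section

variable {Θ : Type*} [MeasurableSpace Θ] {d : ℕ} {n : Fin d → ℕ} {κ : Type*} [Fintype κ]

theorem weightedAtoms_univ {s : Fin d → κ → ℝ} (hs : ∀ j k, 0 < s j k) (τ : κ → Θ) (j : Fin d) :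
    weightedAtoms s τ j Set.univ = ENNReal.ofReal (∑ k, s j k) := by
  rw [weightedAtoms, Measure.finsetSum_apply, ENNReal.ofReal_sum_of_nonneg fun k _ => (hs j k).le]
  simp

open Classical in
theorem pi_pi_normalized_weightedAtoms [Nonempty κ] {s : Fin d → κ → ℝ} (hs : ∀ j k, 0 < s j k)
    (τ : κ → Θ) :
    Measure.pi (fun j => Measure.pi fun _ : Fin (n j) => normalized (weightedAtoms s τ j))
      = ∑ c : (j : Fin d) → Fin (n j) → κ,
        (∏ j, ∏ i, (ENNReal.ofReal (∑ k, s j k))⁻¹ * ENNReal.ofReal (s j (c j i))) •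
          Measure.dirac (fun j i => τ (c j i)) := by
  have hT : ∀ j, 0 < ∑ k, s j k := fun j => Finset.sum_pos (fun k _ => hs j k) Finset.univ_nonempty
  have ht : ∀ j k, (ENNReal.ofReal (∑ k, s j k))⁻¹ * ENNReal.ofReal (s j k) ≠ ∞ := fun j k =>
    ENNReal.mul_ne_top (ENNReal.inv_ne_top.2 (by simpa using hT j)) ENNReal.ofReal_ne_top
  have h1 : ∀ j, normalized (weightedAtoms s τ j)
      = ∑ k, ((ENNReal.ofReal (∑ k, s j k))⁻¹ * ENNReal.ofReal (s j k)) • Measure.dirac (τ k) := by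
    intro j
    rw [normalized, weightedAtoms_univ hs, weightedAtoms, Finset.smul_sum]
    simp_rw [smul_smul]
  simp_rw [h1]
  simp_rw [fun j => pi_sum_smul_dirac (fun _ : Fin (n j) => fun k =>
    (ENNReal.ofReal (∑ k, s j k))⁻¹ * ENNReal.ofReal (s j k)) (fun _ => ht j) (fun _ => τ)]
  rw [pi_sum_smul_dirac (fun j (c : Fin (n j) → κ) => ∏ i, (ENNReal.ofReal (∑ k, s j k))⁻¹
    * ENNReal.ofReal (s j (c i))) (fun j c => ENNReal.prod_ne_top fun i _ => ht j (c i))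
    (fun j c i => τ (c i))]

-- The factor $T_j^{-n_j}$ from normalizing $\mu_j$ in $n_j$ draws cancels $T_j^{n_j}$ from the
-- gamma density. The remaining $e^{-u_jT_j}$ is a product over atoms, unlike a power of the total
-- mass.
open Classical in
theorem lintegral_samplingLaw_weightedAtoms (hn : ∀ j, 0 < n j) [Nonempty κ] {s : Fin d → κ → ℝ}
    (hs : ∀ j k, 0 < s j k) (τ : κ → Θ)
    {F : ((j : Fin d) → Fin (n j) → Θ) × (Fin d → ℝ) → ℝ≥0∞} (hF : Measurable F) :
    ∫⁻ x, F x ∂(samplingLaw n (weightedAtoms s τ))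
      = ∫⁻ u, (∏ j, ENNReal.ofReal (Real.exp (u j))) * ∑ c : (j : Fin d) → Fin (n j) → κ,
          (∏ j, ∏ k, tiltWeight (groupCount c j k) (u j) (s j k)) *
            F (fun j i => τ (c j i), u) ∂(gammaVector n) := by
  have hT : ∀ j, 0 < ∑ k, s j k := fun j => Finset.sum_pos (fun k _ => hs j k) Finset.univ_nonempty
  have hγ := isProbabilityMeasure_gammaVector hn
  have hF' := fun θ : (j : Fin d) → Fin (n j) → Θ => hF.comp (measurable_prodMk_left (x := θ))
  simp only [Function.comp_def] at hF'
  have hg := fun j => isProbabilityMeasure_gammaMeasure (a := n j) (r := ∑ k, s j k)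
    (by exact_mod_cast hn j) (hT j)
  rw [samplingLaw, pi_pi_normalized_weightedAtoms hs]
  simp_rw [weightedAtoms_univ hs, ENNReal.toReal_ofReal (hT _).le]
  rw [lintegral_prod _ hF.aemeasurable, lintegral_finsetSum_measure]
  have hm : Measurable fun θ => ∫⁻ u, F (θ, u) ∂(Measure.pi fun j => gammaMeasure (n j) (∑ k, s j k)) :=
    hF.lintegral_prod_right'
  simp_rw [lintegral_smul_measure, lintegral_dirac' _ hm, pi_gammaMeasure_eq_withDensity hn hT]
  have hD : Measurable fun u : Fin d → ℝ => ∏ j, ENNReal.ofReal ((∑ k, s j k) ^ n j) *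
        (ENNReal.ofReal (Real.exp (u j)) * ENNReal.ofReal (Real.exp (-(u j * (∑ k, s j k))))) := by
    fun_prop
  simp_rw [fun c : (j : Fin d) → Fin (n j) → κ =>
    lintegral_withDensity_eq_lintegral_mul (gammaVector n) hD (hF' fun j i => τ (c j i))]
  refine (Finset.sum_congr rfl fun c _ => (lintegral_const_mul _
    (hD.mul (hF' fun j i => τ (c j i)))).symm).trans ?_
  rw [← lintegral_finsetSum _ fun c _ => (hD.mul (hF' fun j i => τ (c j i))).const_mul _]
  refine lintegral_congr fun u => ?_
  rw [Finset.mul_sum]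
  refine Finset.sum_congr rfl fun c _ => ?_
  rw [Pi.mul_apply, ← mul_assoc, ← mul_assoc, ← Finset.prod_mul_distrib, ← Finset.prod_mul_distrib]
  congr 1
  refine Finset.prod_congr rfl fun j _ => ?_
  rw [prod_tiltWeight_groupCount c j (u j) (hs j), Finset.prod_mul_distrib, Finset.prod_const,
    Finset.card_univ, Fintype.card_fin, ENNReal.ofReal_pow (hT j).le]
  have h0 : ENNReal.ofReal (∑ k, s j k) ≠ 0 := by simpa using hT j
  have h1 : (ENNReal.ofReal (∑ k, s j k))⁻¹ ^ n j * ENNReal.ofReal (∑ k, s j k) ^ n j = 1 := by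
    rw [← mul_pow, ENNReal.inv_mul_cancel h0 ENNReal.ofReal_ne_top, one_pow]
  calc _ = ((ENNReal.ofReal (∑ k, s j k))⁻¹ ^ n j * ENNReal.ofReal (∑ k, s j k) ^ n j) *
        (ENNReal.ofReal (Real.exp (u j)) * (ENNReal.ofReal (Real.exp (-(u j * ∑ k, s j k))) *
          ∏ i, ENNReal.ofReal (s j (c j i)))) := by ring
    _ = _ := by rw [h1, one_mul]

end

/-! ### Markov kernel versions of the sampling law, and the joint law for a fixed number of atoms -/

/-- The family `law` need not be a kernel everywhere. Any Markov kernel that agrees with it almost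
everywhere computes the joint law. -/
theorem lintegral_of_hasCondLaw {Ω α β : Type*} [MeasurableSpace Ω] [MeasurableSpace α]
    [MeasurableSpace β] {P : Measure Ω} [IsProbabilityMeasure P] {X : Ω → α} {Y : Ω → β}
    {Q : Measure α} {law : α → Measure β} (hX : HasLaw X Q P) (hY : HasCondLaw Y X law P)
    (κ' : Kernel α β) [IsMarkovKernel κ'] (hκ' : ∀ᵐ x ∂Q, κ' x = law x)
    {F : β × α → ℝ≥0∞} (hF : Measurable F) :
    ∫⁻ ω, F (Y ω, X ω) ∂P = ∫⁻ x, ∫⁻ y, F (y, x) ∂(κ' x) ∂Q := by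
  obtain ⟨κ, hκ, hcond, hlaw⟩ := hY
  have hF' : Measurable fun p : α × β => F (p.2, p.1) := hF.comp measurable_swap
  rw [← hX.map_eq] at hκ' ⊢
  have := Measure.isProbabilityMeasure_map (μ := P) hX.aemeasurable
  have h1 : ∫⁻ ω, F (Y ω, X ω) ∂P = ∫⁻ p, F (p.2, p.1) ∂(P.map fun ω => (X ω, Y ω)) := by
    rw [lintegral_map' hF'.aemeasurable hcond.aemeasurable]
  rw [h1, HasLaw.map_eq hcond, Measure.lintegral_compProd hF',
    lintegral_map' (Measurable.lintegral_kernel_prod_right' hF').aemeasurable hX.aemeasurable,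
    lintegral_map' (Measurable.lintegral_kernel_prod_right' (κ := κ') hF').aemeasurable
      hX.aemeasurable]
  refine lintegral_congr_ae ?_
  filter_upwards [hlaw, ae_of_ae_map hX.aemeasurable hκ'] with ω h2 h3
  rw [h2, h3]

section

variable {Θ : Type*} [MeasurableSpace Θ] (P₀ : Measure Θ) [IsProbabilityMeasure P₀] {d : ℕ}
  {n : Fin d → ℕ}

open Classical in
/-- A Markov kernel which is equal to `normalized` where the latter is a probability measure. -/
noncomputable def normalizedKernel : Kernel (Measure Θ) Θ where
  toFun ν := if ν Set.univ ≠ 0 ∧ ν Set.univ ≠ ∞ then normalized ν else P₀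
  measurable' := by
    have hu : Measurable fun ν : Measure Θ => ν Set.univ :=
      Measure.measurable_coe MeasurableSet.univ
    refine Measurable.ite ?_ (Measurable.smul_measure_measure hu.inv measurable_id) measurable_const
    exact (hu (measurableSet_singleton 0).compl).inter (hu (measurableSet_singleton ∞).compl)

instance : IsMarkovKernel (normalizedKernel P₀) := ⟨fun ν => by
  change IsProbabilityMeasure (ite _ _ _)
  split_ifs with h
  · exact isProbabilityMeasure_normalized h.1 h.2
  · infer_instance⟩

open Classical in
/-- A Markov kernel which is equal to `gammaMeasure a` at the positive rates. -/
noncomputable def gammaKernel (a : ℝ) : Kernel ℝ ℝ where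
  toFun r := if 0 < a ∧ 0 < r then gammaMeasure a r else Measure.dirac 0
  measurable' := by
    refine Measurable.ite ((MeasurableSet.const _).inter measurableSet_Ioi) ?_ measurable_const
    refine Measure.measurable_of_measurable_coe _ fun B hB => ?_
    simp_rw [gammaMeasure, withDensity_apply _ hB]
    refine Measurable.lintegral_prod_right' (f := fun p : ℝ × ℝ => gammaPDF a p.1 p.2) ?_
    unfold gammaPDF gammaPDFReal
    exact (Measurable.ite (measurableSet_le measurable_const measurable_snd) (by fun_prop)
      measurable_const).ennreal_ofReal

instance (a : ℝ) : IsMarkovKernel (gammaKernel a) := ⟨fun r => by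
  change IsProbabilityMeasure (ite _ _ _)
  split_ifs with h
  · exact isProbabilityMeasure_gammaMeasure h.1 h.2
  · infer_instance⟩

theorem measurable_totalMass (j : Fin d) :
    Measurable fun μ : Fin d → Measure Θ => μ j Set.univ :=
  (Measure.measurable_coe MeasurableSet.univ).comp (measurable_pi_apply j)

/-- A version of `samplingLaw` which is a Markov kernel. -/
noncomputable def samplingKernel (n : Fin d → ℕ) :
    Kernel (Fin d → Measure Θ) (((j : Fin d) → Fin (n j) → Θ) × (Fin d → ℝ)) :=
  (piKernel fun j => piKernel fun _ : Fin (n j) =>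
      (normalizedKernel P₀).comap (fun μ : Fin d → Measure Θ => μ j) (measurable_pi_apply j)).prod
    (piKernel fun j => (gammaKernel (n j)).comap
      (fun μ : Fin d → Measure Θ => (μ j Set.univ).toReal) (measurable_totalMass j).ennreal_toReal)

instance : IsMarkovKernel (samplingKernel P₀ n) := by
  unfold samplingKernel; infer_instance

theorem samplingKernel_eq_samplingLaw (hn : ∀ j, 0 < n j) {μ : Fin d → Measure Θ}
    (hμ : ∀ j, μ j Set.univ ≠ 0 ∧ μ j Set.univ ≠ ∞) :
    samplingKernel P₀ n μ = samplingLaw n μ := by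
  rw [samplingKernel, Kernel.prod_apply, samplingLaw]
  simp only [piKernel_apply, Kernel.comap_apply]
  congr 2
  · funext j
    congr 1
    funext i
    exact if_pos (hμ j)
  · funext j
    exact if_pos ⟨by exact_mod_cast hn j, ENNReal.toReal_pos (hμ j).1 (hμ j).2⟩

omit [IsProbabilityMeasure P₀] in
theorem lintegral_vecIFPP (q : Measure ℕ) (H : Fin d → Measure ℝ) {F : (Fin d → Measure Θ) → ℝ≥0∞}
    (hF : Measurable F) :
    ∫⁻ μ, F μ ∂(vecIFPP q H P₀) = ∑' m, q {m} * ∫⁻ p, F (weightedAtoms p.1 p.2)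
      ∂((Measure.pi fun j : Fin d => Measure.pi fun _ : Fin m => H j).prod
        (Measure.pi fun _ : Fin m => P₀)) := by
  rw [vecIFPP, lintegral_sum_measure]
  simp_rw [lintegral_smul_measure, fun m => lintegral_map (μ := (Measure.pi fun j : Fin d =>
    Measure.pi fun _ : Fin m => H j).prod (Measure.pi fun _ : Fin m => P₀)) hF
      (measurable_weightedAtoms (d := d))]
  rfl

omit [IsProbabilityMeasure P₀] in
theorem ae_pos_pi_densityLaw {κ : Type*} [Fintype κ] {h : Fin d → ℝ → ℝ}
    (hprob : ∀ j, IsProbabilityMeasure (densityLaw (h j))) :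
    ∀ᵐ p ∂((Measure.pi fun j : Fin d => Measure.pi fun _ : κ => densityLaw (h j)).prod
      (Measure.pi fun _ : κ => P₀)), ∀ j k, 0 < p.1 j k := by
  refine Measure.quasiMeasurePreserving_fst.ae
    (p := fun s : Fin d → κ → ℝ => ∀ j k, 0 < s j k) ?_
  rw [ae_all_iff]
  intro j
  refine (Measure.tendsto_eval_ae_ae (μ := fun j : Fin d => Measure.pi fun _ : κ =>
    densityLaw (h j)) (i := j)).eventually (p := fun s : κ → ℝ => ∀ k, 0 < s k) ?_
  rw [ae_all_iff]
  exact fun k => (Measure.tendsto_eval_ae_ae (μ := fun _ : κ => densityLaw (h j))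
    (i := k)).eventually (ae_pos_densityLaw _)

-- Almost surely there is at least one atom, by `hq`, and all weights are positive, so that
-- normalizing each $\mu_j$ makes sense.
omit [IsProbabilityMeasure P₀] in
theorem ae_vecIFPP_pos {q : Measure ℕ} (hq : q {0} = 0) {h : Fin d → ℝ → ℝ}
    (hprob : ∀ j, IsProbabilityMeasure (densityLaw (h j))) :
    ∀ᵐ μ ∂(vecIFPP q (fun j => densityLaw (h j)) P₀), ∀ j, μ j Set.univ ≠ 0 ∧ μ j Set.univ ≠ ∞ := by
  have hm : MeasurableSet {μ : Fin d → Measure Θ | ∀ j, μ j Set.univ ≠ 0 ∧ μ j Set.univ ≠ ∞} := by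
    rw [Set.ofPred_forall]
    exact MeasurableSet.iInter fun j => (measurable_totalMass j (measurableSet_singleton 0).compl).inter
      (measurable_totalMass j (measurableSet_singleton ∞).compl)
  rw [vecIFPP, Measure.ae_sum_iff]
  intro m
  rcases Nat.eq_zero_or_pos m with rfl | hpos
  · simp [hq]
  refine Measure.ae_smul_measure ?_ _
  rw [ae_map_iff measurable_weightedAtoms.aemeasurable hm]
  have : Nonempty (Fin m) := ⟨⟨0, hpos⟩⟩
  filter_upwards [ae_pos_pi_densityLaw P₀ hprob] with p hp j
  rw [weightedAtoms_univ hp]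
  have : 0 < ∑ k, p.1 j k := Finset.sum_pos (fun k _ => hp j k) Finset.univ_nonempty
  simpa using this

-- Tonelli moves the integral over $u$ outside. For fixed positive $u$ the product of tilting
-- factors then becomes the normalizing mass times the law of the tilted weights.
open Classical in
theorem lintegral_samplingKernel_weightedAtoms (hn : ∀ j, 0 < n j) {h : Fin d → ℝ → ℝ}
    (hmeas : ∀ j, Measurable (h j)) (hprob : ∀ j, IsProbabilityMeasure (densityLaw (h j)))
    {κ : Type*} [Fintype κ] [Nonempty κ]
    {F : (((j : Fin d) → Fin (n j) → Θ) × (Fin d → ℝ)) × (Fin d → Measure Θ) → ℝ≥0∞}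
    (hF : Measurable F) :
    ∫⁻ p, ∫⁻ x, F (x, weightedAtoms p.1 p.2) ∂(samplingKernel P₀ n (weightedAtoms p.1 p.2))
      ∂((Measure.pi fun j : Fin d => Measure.pi fun _ : κ => densityLaw (h j)).prod
        (Measure.pi fun _ : κ => P₀))
      = ∫⁻ u, (∏ j, ENNReal.ofReal (Real.exp (u j))) * ∑ c : (j : Fin d) → Fin (n j) → κ,
          tiltedWeightsMass h (groupCount c) u *
          ∫⁻ p, F ((fun j i => p.2 (c j i), u), weightedAtoms p.1 p.2)
            ∂(markedAtoms P₀ h (groupCount c) u) ∂(gammaVector n) := by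
  have hγ := isProbabilityMeasure_gammaVector hn
  have hFx := fun μ : Fin d → Measure Θ => hF.comp (measurable_prodMk_right (y := μ))
  simp only [Function.comp_def] at hFx
  have h1 : ∀ᵐ p ∂((Measure.pi fun j : Fin d => Measure.pi fun _ : κ => densityLaw (h j)).prod
        (Measure.pi fun _ : κ => P₀)),
      ∫⁻ x, F (x, weightedAtoms p.1 p.2) ∂(samplingKernel P₀ n (weightedAtoms p.1 p.2))
      = ∫⁻ u, (∏ j, ENNReal.ofReal (Real.exp (u j))) * ∑ c : (j : Fin d) → Fin (n j) → κ,
          (∏ j, ∏ k, tiltWeight (groupCount c j k) (u j) (p.1 j k)) *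
            F ((fun j i => p.2 (c j i), u), weightedAtoms p.1 p.2) ∂(gammaVector n) := by
    filter_upwards [ae_pos_pi_densityLaw P₀ hprob] with p hp
    rw [samplingKernel_eq_samplingLaw P₀ hn fun j => by
      rw [weightedAtoms_univ hp]
      have : 0 < ∑ k, p.1 j k := Finset.sum_pos (fun k _ => hp j k) Finset.univ_nonempty
      simpa using this]
    exact lintegral_samplingLaw_weightedAtoms hn hp p.2 (hFx _)
  have hW : ∀ c : (j : Fin d) → Fin (n j) → κ,
      Measurable fun r : ((Fin d → κ → ℝ) × (κ → Θ)) × (Fin d → ℝ) =>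
        ∏ j, ∏ k, tiltWeight (groupCount c j k) (r.2 j) (r.1.1 j k) := fun c =>
    Finset.measurable_fun_prod _ fun j _ => Finset.measurable_fun_prod _ fun k _ =>
      Measurable.tiltWeight _ (by fun_prop) (by fun_prop)
  have hFc : ∀ c : (j : Fin d) → Fin (n j) → κ,
      Measurable fun r : ((Fin d → κ → ℝ) × (κ → Θ)) × (Fin d → ℝ) =>
        F ((fun j i => r.1.2 (c j i), r.2), weightedAtoms r.1.1 r.1.2) := fun c =>
    hF.comp (Measurable.prodMk (by fun_prop) (measurable_weightedAtoms.comp measurable_fst))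
  have hE : Measurable fun u : Fin d → ℝ => ∏ j, ENNReal.ofReal (Real.exp (u j)) := by fun_prop
  have hS : Measurable fun r : ((Fin d → κ → ℝ) × (κ → Θ)) × (Fin d → ℝ) =>
      (∏ j, ENNReal.ofReal (Real.exp (r.2 j))) * ∑ c : (j : Fin d) → Fin (n j) → κ,
          (∏ j, ∏ k, tiltWeight (groupCount c j k) (r.2 j) (r.1.1 j k)) *
            F ((fun j i => r.1.2 (c j i), r.2), weightedAtoms r.1.1 r.1.2) :=
    (hE.comp measurable_snd).mul (Finset.measurable_fun_sum _ fun c _ => (hW c).mul (hFc c))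
  rw [lintegral_congr_ae h1, lintegral_lintegral_swap hS.aemeasurable]
  refine lintegral_congr_ae ?_
  filter_upwards [ae_pos_gammaVector hn] with u hu
  have hWu := fun c => (hW c).comp (measurable_prodMk_right (y := u))
  have hFu := fun c => (hFc c).comp (measurable_prodMk_right (y := u))
  simp only [Function.comp_def] at hWu hFu
  have hWF : ∀ c : (j : Fin d) → Fin (n j) → κ, Measurable fun p : (Fin d → κ → ℝ) × (κ → Θ) =>
      (∏ j, ∏ k, tiltWeight (groupCount c j k) (u j) (p.1 j k)) *
        F ((fun j i => p.2 (c j i), u), weightedAtoms p.1 p.2) := fun c => (hWu c).mul (hFu c)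
  rw [lintegral_const_mul _ (Finset.measurable_fun_sum _ fun c _ => hWF c),
    lintegral_finsetSum _ fun c _ => hWF c]
  congr 1
  refine Finset.sum_congr rfl fun c _ => ?_
  have := isProbabilityMeasure_tiltedWeights hmeas hprob hu (groupCount c)
  rw [lintegral_prod _ (hWF c).aemeasurable, markedAtoms,
    lintegral_prod _ (hFu c).aemeasurable, ← smul_eq_mul, ← lintegral_smul_measure,
    ← withDensity_tiltedWeights hmeas hprob hu, lintegral_withDensity_eq_lintegral_mul]
  · refine lintegral_congr fun s => ?_
    simp only [Pi.mul_apply]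
    exact lintegral_const_mul _ ((hFu c).comp measurable_prodMk_left)
  · exact Finset.measurable_fun_prod _ fun j _ => Finset.measurable_fun_prod _ fun k _ =>
      Measurable.tiltWeight _ (by fun_prop) (by fun_prop)
  · exact (hFu c).lintegral_prod_right'

end

/-! ### Markov kernels for the two components and for their superposition -/

/-- A Markov kernel which is equal to `tiltedLaw h c u` for `u > 0`. -/
noncomputable def tiltedKernel {h : ℝ → ℝ} (hmeas : Measurable h) (c : ℕ) : Kernel ℝ ℝ :=
  (normalizedKernel (Measure.dirac 0)).comap
    (fun u => densityLaw fun s => Real.exp (-(u * s)) * s ^ c * h s)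
    (measurable_densityLaw_tilt hmeas c)

instance {h : ℝ → ℝ} (hmeas : Measurable h) (c : ℕ) : IsMarkovKernel (tiltedKernel hmeas c) := by
  unfold tiltedKernel; infer_instance

theorem tiltedKernel_apply {h : ℝ → ℝ} (hmeas : Measurable h)
    [IsProbabilityMeasure (densityLaw h)] (c : ℕ) {u : ℝ} (hu : 0 < u) :
    tiltedKernel hmeas c u = tiltedLaw h c u :=
  if_pos ⟨tiltedMass_ne_zero hmeas c u, tiltedMass_ne_top hmeas c hu⟩

section Kernels

variable {Θ : Type*} [MeasurableSpace Θ] (P₀ : Measure Θ) [IsProbabilityMeasure P₀] {d : ℕ}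
  {κ κ' : Type*} [Fintype κ] [Fintype κ'] {h : Fin d → ℝ → ℝ} (hmeas : ∀ j, Measurable (h j))
  (hprob : ∀ j, IsProbabilityMeasure (densityLaw (h j)))

/-- A Markov kernel which is equal to `tiltedWeights h N u` when all `u_j` are positive. -/
noncomputable def weightsKernel (N : Fin d → κ → ℕ) : Kernel (Fin d → ℝ) (Fin d → κ → ℝ) :=
  piKernel fun j => piKernel fun k => (tiltedKernel (hmeas j) (N j k)).comap
    (fun u : Fin d → ℝ => u j) (measurable_pi_apply j)

instance (N : Fin d → κ → ℕ) : IsMarkovKernel (weightsKernel hmeas N) := by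
  unfold weightsKernel; infer_instance

include hprob in
theorem weightsKernel_apply (N : Fin d → κ → ℕ) {u : Fin d → ℝ} (hu : ∀ j, 0 < u j) :
    weightsKernel hmeas N u = tiltedWeights h N u := by
  simp only [weightsKernel, piKernel_apply, Kernel.comap_apply, tiltedWeights,
    fun j k => tiltedKernel_apply (hmeas j) (N j k) (hu j)]

/-- A Markov kernel which is equal to `markedAtoms P₀ h N u` when all `u_j` are positive. -/
noncomputable def markedKernel (N : Fin d → κ → ℕ) :
    Kernel (Fin d → ℝ) ((Fin d → κ → ℝ) × (κ → Θ)) :=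
  (weightsKernel hmeas N).prod (Kernel.const _ (Measure.pi fun _ => P₀))

instance (N : Fin d → κ → ℕ) : IsMarkovKernel (markedKernel P₀ hmeas N) := by
  unfold markedKernel; infer_instance

include hprob in
theorem markedKernel_apply (N : Fin d → κ → ℕ) {u : Fin d → ℝ} (hu : ∀ j, 0 < u j) :
    markedKernel P₀ hmeas N u = markedAtoms P₀ h N u := by
  rw [markedKernel, Kernel.prod_apply, weightsKernel_apply hmeas hprob N hu, Kernel.const_apply,
    markedAtoms]

/-- The weight of `m` in the law `q*_M`, before normalization. -/
noncomputable def qStarWeight (q : Measure ℕ) (h : Fin d → ℝ → ℝ) (K : ℕ) (u : Fin d → ℝ) (m : ℕ) :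
    ℝ≥0∞ :=
  q {m + K} * (((m + K) ! : ℝ≥0∞) / (m ! : ℝ≥0∞)) * ∏ j, laplaceTransform (h j) (u j) ^ m

/-- The normalizing constant of the law `q*_M`. -/
noncomputable def qStarMass (q : Measure ℕ) (h : Fin d → ℝ → ℝ) (K : ℕ) (u : Fin d → ℝ) : ℝ≥0∞ :=
  ∑' m, qStarWeight q h K u m

theorem count_withDensity_univ (f : ℕ → ℝ≥0∞) :
    (Measure.count.withDensity f) Set.univ = ∑' m, f m := by
  rw [withDensity_apply _ MeasurableSet.univ, setLIntegral_univ, lintegral_count]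

theorem qStar_singleton (q : Measure ℕ) (h : Fin d → ℝ → ℝ) (K : ℕ) (u : Fin d → ℝ) (m : ℕ) :
    qStar q h K u {m} = (qStarMass q h K u)⁻¹ * qStarWeight q h K u m := by
  rw [qStar, normalized, Measure.smul_apply, count_withDensity_univ,
    withDensity_apply _ (measurableSet_singleton m), Measure.restrict_singleton]
  simp [qStarMass, qStarWeight]

theorem qStarWeight_eq_qStarMass_mul {q : Measure ℕ} {h : Fin d → ℝ → ℝ} {K : ℕ} {u : Fin d → ℝ}
    (hfin : qStarMass q h K u ≠ ∞) (m : ℕ) :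
    qStarWeight q h K u m = qStarMass q h K u * qStar q h K u {m} := by
  rw [qStar_singleton, ← mul_assoc]
  -- A vanishing total forces each weight to vanish, so the identity survives although `qStar` is
  -- then not a probability measure.
  by_cases h0 : qStarMass q h K u = 0
  · rw [h0, zero_mul, zero_mul]
    exact ENNReal.tsum_eq_zero.1 h0 m
  · rw [ENNReal.mul_inv_cancel h0 hfin, one_mul]

include hmeas in
theorem measurable_qStarWeight (q : Measure ℕ) (K m : ℕ) :
    Measurable fun u => qStarWeight q h K u m := by
  refine Measurable.const_mul (Finset.measurable_fun_prod _ fun j _ => Measurable.pow_const ?_ _) _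
  simp_rw [← fun u => tiltedMass_zero_eq_laplaceTransform (hmeas j) u]
  exact (measurable_tiltedMass (hmeas j) 0).comp (measurable_pi_apply j)

include hmeas in
theorem measurable_qStarMass (q : Measure ℕ) (K : ℕ) : Measurable fun u => qStarMass q h K u :=
  Measurable.tsum fun m => measurable_qStarWeight hmeas q K m

/-- A Markov kernel which is equal to `qStar q h K u` when the latter is a probability measure. -/
noncomputable def qStarKernel (q : Measure ℕ) (K : ℕ) : Kernel (Fin d → ℝ) ℕ :=
  (normalizedKernel (Measure.dirac 0)).comap
    (fun u => Measure.count.withDensity fun m => qStarWeight q h K u m) (by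
      refine Measure.measurable_of_measurable_coe _ fun B hB => ?_
      simp_rw [withDensity_apply _ hB, ← lintegral_indicator hB, lintegral_count]
      refine Measurable.tsum fun m => ?_
      by_cases hm : m ∈ B
      · simpa [hm] using measurable_qStarWeight hmeas q K m
      · simp [hm])

instance (q : Measure ℕ) (K : ℕ) : IsMarkovKernel (qStarKernel hmeas q K) := by
  unfold qStarKernel; infer_instance

theorem qStarKernel_apply {q : Measure ℕ} {K : ℕ} {u : Fin d → ℝ}
    (h0 : qStarMass q h K u ≠ 0) (hfin : qStarMass q h K u ≠ ∞) :
    qStarKernel hmeas q K u = qStar q h K u :=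
  if_pos (by rw [count_withDensity_univ]; exact ⟨h0, hfin⟩)

/-- A Markov kernel which is equal to `nonallocatedLaw q h P₀ K u` when all `u_j` are positive and
`q*_M` is a probability measure. -/
noncomputable def nonallocatedKernel (q : Measure ℕ) (K : ℕ) :
    Kernel (Fin d → ℝ) (Fin d → Measure Θ) where
  toFun u := Measure.sum fun m : ℕ => qStarKernel hmeas q K u {m} •
    (markedKernel P₀ hmeas (fun _ (_ : Fin m) => 0) u).map fun p => weightedAtoms p.1 p.2
  measurable' := by
    refine Measure.measurable_of_measurable_coe _ fun B hB => ?_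
    simp_rw [Measure.sum_apply _ hB, Measure.smul_apply, smul_eq_mul]
    refine Measurable.tsum fun m => ?_
    refine ((qStarKernel hmeas q K).measurable_coe (measurableSet_singleton m)).mul ?_
    simp_rw [Measure.map_apply measurable_weightedAtoms hB]
    exact Kernel.measurable_coe _ (measurable_weightedAtoms hB)

instance (q : Measure ℕ) (K : ℕ) : IsMarkovKernel (nonallocatedKernel P₀ hmeas q K) := ⟨fun u => ⟨by
  change (Measure.sum _) Set.univ = 1
  simp_rw [Measure.sum_apply _ MeasurableSet.univ, Measure.smul_apply,
    Measure.map_apply measurable_weightedAtoms MeasurableSet.univ, Set.preimage_univ, measure_univ,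
    smul_eq_mul, mul_one]
  have := Measure.tsum_indicator_apply_singleton (qStarKernel hmeas q K u) Set.univ
    MeasurableSet.univ
  simpa using this⟩⟩

include hprob in
theorem nonallocatedKernel_apply {q : Measure ℕ} {K : ℕ} {u : Fin d → ℝ} (hu : ∀ j, 0 < u j)
    (h0 : qStarMass q h K u ≠ 0) (hfin : qStarMass q h K u ≠ ∞) :
    nonallocatedKernel P₀ hmeas q K u = nonallocatedLaw q h P₀ K u := by
  change Measure.sum _ = _
  simp_rw [nonallocatedLaw, vecIFPP, qStarKernel_apply hmeas h0 hfin,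
    markedKernel_apply P₀ hmeas hprob _ hu, markedAtoms, tiltedWeights, tiltedLaw, pow_zero, mul_one]

omit [IsProbabilityMeasure P₀] in
theorem lintegral_nonallocatedKernel {q : Measure ℕ} {K : ℕ} {u : Fin d → ℝ}
    (h0 : qStarMass q h K u ≠ 0) (hfin : qStarMass q h K u ≠ ∞)
    {F : (Fin d → Measure Θ) → ℝ≥0∞} (hF : Measurable F) :
    ∫⁻ ν, F ν ∂(nonallocatedKernel P₀ hmeas q K u) = ∑' m, qStar q h K u {m} *
      ∫⁻ b, F (weightedAtoms b.1 b.2) ∂(markedKernel P₀ hmeas (fun _ (_ : Fin m) => 0) u) := by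
  change ∫⁻ ν, F ν ∂(Measure.sum _) = _
  rw [lintegral_sum_measure]
  refine tsum_congr fun m => ?_
  rw [lintegral_smul_measure, lintegral_map hF measurable_weightedAtoms,
    qStarKernel_apply hmeas h0 hfin, smul_eq_mul]

/-- The law of the sum of the allocated component with atoms `x` and of the non-allocated
component, as a kernel in `(x, u)`. -/
noncomputable def posteriorKernel (q : Measure ℕ) (N : Fin d → κ → ℕ) :
    Kernel ((κ → Θ) × (Fin d → ℝ)) (Fin d → Measure Θ) :=
  (((Kernel.deterministic (Prod.fst : (κ → Θ) × (Fin d → ℝ) → κ → Θ) measurable_fst).prod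
    ((weightsKernel hmeas N).comap Prod.snd measurable_snd)).prod
      ((nonallocatedKernel P₀ hmeas q (Fintype.card κ)).comap Prod.snd measurable_snd)).map
        fun p => weightedAtoms p.1.2 p.1.1 + p.2

theorem measurable_posterior_sum :
    Measurable fun p : ((κ → Θ) × (Fin d → κ → ℝ)) × (Fin d → Measure Θ) =>
      weightedAtoms p.1.2 p.1.1 + p.2 :=
  measurable_vector_add.comp ((measurable_weightedAtoms.comp
    (show Measurable fun p : ((κ → Θ) × (Fin d → κ → ℝ)) × (Fin d → Measure Θ) =>
      (p.1.2, p.1.1) by fun_prop)).prodMk measurable_snd)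

instance (q : Measure ℕ) (N : Fin d → κ → ℕ) : IsMarkovKernel (posteriorKernel P₀ hmeas q N) := by
  unfold posteriorKernel
  exact Kernel.IsMarkovKernel.map _ measurable_posterior_sum

theorem lintegral_posteriorKernel (q : Measure ℕ) (N : Fin d → κ → ℕ) (x : κ → Θ) (u : Fin d → ℝ)
    {F : (Fin d → Measure Θ) → ℝ≥0∞} (hF : Measurable F) :
    ∫⁻ y, F y ∂(posteriorKernel P₀ hmeas q N (x, u))
      = ∫⁻ s, ∫⁻ ν, F (weightedAtoms s x + ν) ∂(nonallocatedKernel P₀ hmeas q (Fintype.card κ) u)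
          ∂(weightsKernel hmeas N u) := by
  have h1 := hF.comp (measurable_posterior_sum (Θ := Θ) (d := d) (κ := κ))
  simp only [Function.comp_def] at h1
  rw [posteriorKernel, Kernel.map_apply _ measurable_posterior_sum,
    lintegral_map hF measurable_posterior_sum, Kernel.prod_apply, Kernel.prod_apply,
    lintegral_prod _ h1.aemeasurable, Kernel.deterministic_apply, Kernel.comap_apply,
    Kernel.comap_apply, lintegral_prod _ h1.lintegral_prod_right'.aemeasurable, lintegral_dirac']
  exact (h1.lintegral_prod_right' (ν := nonallocatedKernel P₀ hmeas q (Fintype.card κ) u)).lintegral_prod_right'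
    (ν := weightsKernel hmeas N u)

include hprob in
theorem posteriorKernel_apply {q : Measure ℕ} (N : Fin d → κ → ℕ) (x : κ → Θ) {u : Fin d → ℝ}
    (hu : ∀ j, 0 < u j) (h0 : qStarMass q h (Fintype.card κ) u ≠ 0)
    (hfin : qStarMass q h (Fintype.card κ) u ≠ ∞) :
    posteriorKernel P₀ hmeas q N (x, u)
      = superpositionLaw ((tiltedWeights h N u).map fun s => weightedAtoms s x)
          (nonallocatedLaw q h P₀ (Fintype.card κ) u) := by
  have hw : Measurable fun s : Fin d → κ → ℝ => weightedAtoms s x :=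
    measurable_weightedAtoms.comp measurable_prodMk_right
  rw [superpositionLaw, ← weightsKernel_apply hmeas hprob N hu,
    ← nonallocatedKernel_apply P₀ hmeas hprob hu h0 hfin]
  have : IsProbabilityMeasure ((weightsKernel hmeas N u).map fun s => weightedAtoms s x) :=
    Measure.isProbabilityMeasure_map hw.aemeasurable
  refine Measure.ext_of_lintegral _ fun F hF => ?_
  have hF' := hF.comp (measurable_vector_add (X := Θ) (d := d))
  simp only [Function.comp_def] at hF'
  rw [lintegral_posteriorKernel P₀ hmeas q N x u hF, lintegral_map hF measurable_vector_add,
    lintegral_prod _ hF'.aemeasurable, lintegral_map hF'.lintegral_prod_right' hw]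

-- Normalizing the weights of $q^*_M$ turns the series over the number of free atoms into an
-- expectation under the non-allocated law. If the mass is zero both sides vanish, whatever the
-- default value of the kernel.
include hprob in
theorem tsum_qStarWeight_mul {q : Measure ℕ} (N : Fin d → κ → ℕ) {u : Fin d → ℝ}
    (hu : ∀ j, 0 < u j) (hfin : qStarMass q h (Fintype.card κ) u ≠ ∞)
    {F : (κ → Θ) × (Fin d → Measure Θ) → ℝ≥0∞} (hF : Measurable F) :
    ∑' l, qStarWeight q h (Fintype.card κ) u l *
        ∫⁻ a, ∫⁻ b, F (a.2, weightedAtoms a.1 a.2 + weightedAtoms b.1 b.2)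
          ∂(markedAtoms P₀ h (fun _ (_ : Fin l) => 0) u) ∂(markedAtoms P₀ h N u)
      = qStarMass q h (Fintype.card κ) u *
        ∫⁻ x, ∫⁻ y, F (x, y) ∂(posteriorKernel P₀ hmeas q N (x, u))
          ∂(Measure.pi fun _ : κ => P₀) := by
  by_cases h0 : qStarMass q h (Fintype.card κ) u = 0
  · simp_rw [qStarWeight_eq_qStarMass_mul hfin, h0]
    simp
  simp_rw [qStarWeight_eq_qStarMass_mul hfin, mul_assoc]
  rw [ENNReal.tsum_mul_left]
  congr 1
  simp_rw [← markedKernel_apply P₀ hmeas hprob _ hu]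
  have hFx := fun x : κ → Θ => hF.comp (measurable_prodMk_left (x := x))
  simp only [Function.comp_def] at hFx
  have hFa := fun (x : κ → Θ) (s : Fin d → κ → ℝ) => (hFx x).comp (measurable_vector_add.comp
    (measurable_prodMk_left (x := weightedAtoms s x)))
  simp only [Function.comp_def] at hFa
  simp_rw [fun x => lintegral_posteriorKernel P₀ hmeas q N x u (hFx x),
    fun x s => lintegral_nonallocatedKernel P₀ hmeas h0 hfin (hFa x s)]
  have hJ : ∀ l, Measurable fun r : ((Fin d → κ → ℝ) × (κ → Θ)) × ((Fin d → Fin l → ℝ) × (Fin l → Θ)) =>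
      F (r.1.2, weightedAtoms r.1.1 r.1.2 + weightedAtoms r.2.1 r.2.2) := fun l =>
    hF.comp (Measurable.prodMk (by fun_prop) (measurable_vector_add.comp
      ((measurable_weightedAtoms.comp measurable_fst).prodMk
        (measurable_weightedAtoms.comp measurable_snd))))
  have hI : ∀ l, Measurable fun a : (Fin d → κ → ℝ) × (κ → Θ) => ∫⁻ b,
      F (a.2, weightedAtoms a.1 a.2 + weightedAtoms b.1 b.2)
        ∂(markedKernel P₀ hmeas (fun _ (_ : Fin l) => 0) u) := fun l => (hJ l).lintegral_prod_right'
  simp_rw [← fun l => lintegral_const_mul (μ := markedKernel P₀ hmeas N u)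
    (qStar q h (Fintype.card κ) u {l}) (hI l)]
  rw [← lintegral_tsum fun l => ((hI l).const_mul _).aemeasurable, markedKernel, Kernel.prod_apply,
    Kernel.const_apply, lintegral_prod_symm]
  exact (Measurable.tsum fun l => (hI l).const_mul _).aemeasurable

end Kernels

/-! ### The joint law sorted by partitions, and the posterior as a kernel in the data -/

section

open Classical

variable {Θ : Type*} [MeasurableSpace Θ] (P₀ : Measure Θ) [IsProbabilityMeasure P₀] {d : ℕ}
  {n : Fin d → ℕ} {h : Fin d → ℝ → ℝ} (hmeas : ∀ j, Measurable (h j))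
  (hprob : ∀ j, IsProbabilityMeasure (densityLaw (h j)))

include hmeas hprob in
theorem lintegral_samplingKernel_vecIFPP (hn : ∀ j, 0 < n j) {q : Measure ℕ} (hq : q {0} = 0)
    {F : (((j : Fin d) → Fin (n j) → Θ) × (Fin d → ℝ)) × (Fin d → Measure Θ) → ℝ≥0∞}
    (hF : Measurable F) :
    ∫⁻ μ, ∫⁻ x, F (x, μ) ∂(samplingKernel P₀ n μ) ∂(vecIFPP q (fun j => densityLaw (h j)) P₀)
      = ∫⁻ u, (∏ j, ENNReal.ofReal (Real.exp (u j))) * ∑ π : Setoid (ObsIndex n),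
          tiltedWeightsMass h (groupCount (blockArray π)) u *
            ∑' l, qStarWeight q h (Fintype.card (Quotient π)) u l *
              partitionIntegral P₀ h u (fun p => F ((p.1, u), p.2)) π l ∂(gammaVector n) := by
  have hF' : Measurable fun p : (Fin d → Measure Θ) × (((j : Fin d) → Fin (n j) → Θ) × (Fin d → ℝ))
      => F (p.2, p.1) := hF.comp measurable_swap
  rw [lintegral_vecIFPP P₀ q _ (hF'.lintegral_kernel_prod_right' (κ := samplingKernel P₀ n))]
  have hE : Measurable fun u : Fin d → ℝ => ∏ j, ENNReal.ofReal (Real.exp (u j)) := by fun_prop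
  have hA : ∀ m, AEMeasurable (fun u => (∏ j, ENNReal.ofReal (Real.exp (u j))) *
      ∑ c : (j : Fin d) → Fin (n j) → Fin m, tiltedWeightsMass h (groupCount c) u *
          ∫⁻ p, F ((fun j i => p.2 (c j i), u), weightedAtoms p.1 p.2)
            ∂(markedAtoms P₀ h (groupCount c) u)) (gammaVector n) := by
    intro m
    -- Measurability in `u` is clear for the Markov kernel `markedKernel`, which agrees with
    -- `markedAtoms` at positive `u`, hence almost everywhere.
    refine ⟨fun u => (∏ j, ENNReal.ofReal (Real.exp (u j))) *
      ∑ c : (j : Fin d) → Fin (n j) → Fin m, tiltedWeightsMass h (groupCount c) u *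
          ∫⁻ p, F ((fun j i => p.2 (c j i), u), weightedAtoms p.1 p.2)
            ∂(markedKernel P₀ hmeas (groupCount c) u), ?_, ?_⟩
    · refine hE.mul (Finset.measurable_fun_sum _ fun c _ =>
        (measurable_tiltedWeightsMass hmeas _).mul ?_)
      refine Measurable.lintegral_kernel_prod_right' (κ := markedKernel P₀ hmeas (groupCount c))
        (f := fun r => F ((fun j i => r.2.2 (c j i), r.1), weightedAtoms r.2.1 r.2.2)) ?_
      exact hF.comp (Measurable.prodMk (by fun_prop) (measurable_weightedAtoms.comp measurable_snd))
    · filter_upwards [ae_pos_gammaVector hn] with u hu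
      simp_rw [markedKernel_apply P₀ hmeas hprob _ hu]
  have h1 : ∀ m, q {m} * ∫⁻ p, ∫⁻ x, F (x, weightedAtoms p.1 p.2)
        ∂(samplingKernel P₀ n (weightedAtoms p.1 p.2))
        ∂((Measure.pi fun j : Fin d => Measure.pi fun _ : Fin m => densityLaw (h j)).prod
          (Measure.pi fun _ : Fin m => P₀))
      = ∫⁻ u, q {m} * ((∏ j, ENNReal.ofReal (Real.exp (u j))) *
      ∑ c : (j : Fin d) → Fin (n j) → Fin m, tiltedWeightsMass h (groupCount c) u *
          ∫⁻ p, F ((fun j i => p.2 (c j i), u), weightedAtoms p.1 p.2)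
            ∂(markedAtoms P₀ h (groupCount c) u)) ∂(gammaVector n) := by
    intro m
    rw [lintegral_const_mul'' _ (hA m)]
    rcases Nat.eq_zero_or_pos m with rfl | hpos
    · rw [hq, zero_mul, zero_mul]
    · have : Nonempty (Fin m) := ⟨⟨0, hpos⟩⟩
      rw [lintegral_samplingKernel_weightedAtoms P₀ hn hmeas hprob hF]
  rw [tsum_congr h1, ← lintegral_tsum fun m => (hA m).const_mul _]
  refine lintegral_congr_ae ?_
  filter_upwards [ae_pos_gammaVector hn] with u hu
  simp_rw [mul_left_comm (q _)]
  rw [ENNReal.tsum_mul_left]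
  congr 1
  exact tsum_sum_array_eq P₀ hmeas hprob hu q (F := fun p => F ((p.1, u), p.2))
    (hF.comp (by fun_prop))

/-- The partition of the indices of the observations into the sets of equal observations. -/
def obsPartition (θ : (j : Fin d) → Fin (n j) → Θ) : Setoid (ObsIndex n) :=
  Setoid.ker fun a : ObsIndex n => θ a.1 a.2

omit [MeasurableSpace Θ] in
theorem obsPartition_comp_blockArray (π : Setoid (ObsIndex n)) {x : Quotient π → Θ}
    (hx : Function.Injective x) : obsPartition (fun j i => x (blockArray π j i)) = π :=
  Setoid.ext fun a b => by
    change x (Quotient.mk π a) = x (Quotient.mk π b) ↔ _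
    rw [hx.eq_iff, Quotient.eq]

theorem measurableSet_obsPartition_eq [MeasurableEq Θ] (π : Setoid (ObsIndex n)) :
    MeasurableSet {θ : (j : Fin d) → Fin (n j) → Θ | obsPartition θ = π} := by
  have : {θ : (j : Fin d) → Fin (n j) → Θ | obsPartition θ = π}
      = ⋂ a : ObsIndex n, ⋂ b : ObsIndex n, {θ | θ a.1 a.2 = θ b.1 b.2 ↔ π a b} := by
    ext θ
    simp only [Set.mem_ofPred_eq, Set.mem_iInter]
    exact ⟨fun hθ a b => hθ ▸ Iff.rfl, fun hθ => Setoid.ext hθ⟩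
  rw [this]
  refine MeasurableSet.iInter fun a => MeasurableSet.iInter fun b => ?_
  have he : MeasurableSet {θ : (j : Fin d) → Fin (n j) → Θ | θ a.1 a.2 = θ b.1 b.2} :=
    measurableSet_eq_fun (by fun_prop) (by fun_prop)
  by_cases hab : π a b
  · simpa [hab] using he
  · convert he.compl using 1
    ext θ
    simp [hab]

/-- The values of the array `θ` on the blocks of `π`, when `θ` is constant on the blocks. -/
noncomputable def blockValues (π : Setoid (ObsIndex n)) (θ : (j : Fin d) → Fin (n j) → Θ)
    (b : Quotient π) : Θ := θ b.out.1 b.out.2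

theorem measurable_blockValues (π : Setoid (ObsIndex n)) :
    Measurable (blockValues π : ((j : Fin d) → Fin (n j) → Θ) → _) := by
  unfold blockValues; fun_prop

omit [MeasurableSpace Θ] in
theorem blockValues_comp_blockArray (π : Setoid (ObsIndex n)) (x : Quotient π → Θ) :
    blockValues π (fun j i => x (blockArray π j i)) = x :=
  funext fun b => congrArg x (Quotient.out_eq b)

omit [MeasurableSpace Θ] in
theorem blockValues_obsPartition (θ : (j : Fin d) → Fin (n j) → Θ) (j : Fin d) (i : Fin (n j)) :
    blockValues (obsPartition θ) θ (blockArray (obsPartition θ) j i) = θ j i :=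
  Quotient.mk_out (s := obsPartition θ) (⟨j, i⟩ : ObsIndex n)

omit [MeasurableSpace Θ] in
theorem blockValues_injective (θ : (j : Fin d) → Fin (n j) → Θ) :
    Function.Injective (blockValues (obsPartition θ) θ) := by
  intro b b' hb
  rw [← Quotient.out_eq b, ← Quotient.out_eq b']
  exact Quotient.sound hb

/-- The law of `μ` given the data, as a Markov kernel. -/
noncomputable def dataKernel [MeasurableEq Θ] (q : Measure ℕ) :
    Kernel (((j : Fin d) → Fin (n j) → Θ) × (Fin d → ℝ)) (Fin d → Measure Θ) where
  toFun p := posteriorKernel P₀ hmeas q (groupCount (blockArray (obsPartition p.1)))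
    (blockValues (obsPartition p.1) p.1, p.2)
  measurable' := by
    refine Measure.measurable_of_measurable_coe _ fun B hB => ?_
    -- The index type of the blocks varies with the data. Splitting over the finitely many
    -- partitions fixes it on each measurable piece.
    have : (fun p : ((j : Fin d) → Fin (n j) → Θ) × (Fin d → ℝ) =>
        posteriorKernel P₀ hmeas q (groupCount (blockArray (obsPartition p.1)))
          (blockValues (obsPartition p.1) p.1, p.2) B)
        = fun p => ∑ π : Setoid (ObsIndex n), if obsPartition p.1 = π then
          posteriorKernel P₀ hmeas q (groupCount (blockArray π)) (blockValues π p.1, p.2) B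
          else 0 := by
      funext p
      rw [Finset.sum_ite_eq, if_pos (Finset.mem_univ _)]
    rw [this]
    refine Finset.measurable_fun_sum _ fun π _ => Measurable.ite
      (measurable_fst (measurableSet_obsPartition_eq π)) ?_ measurable_const
    exact (Kernel.measurable_coe _ hB).comp
      (((measurable_blockValues π).comp measurable_fst).prodMk measurable_snd)

omit [IsProbabilityMeasure P₀] in
theorem dataKernel_apply [MeasurableEq Θ] (q : Measure ℕ)
    (p : ((j : Fin d) → Fin (n j) → Θ) × (Fin d → ℝ)) :
    dataKernel P₀ hmeas q p = posteriorKernel P₀ hmeas q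
      (groupCount (blockArray (obsPartition p.1))) (blockValues (obsPartition p.1) p.1, p.2) := rfl

instance [MeasurableEq Θ] (q : Measure ℕ) :
    IsMarkovKernel (dataKernel (n := n) P₀ hmeas q) :=
  ⟨fun p => by rw [dataKernel_apply]; infer_instance⟩

omit [IsProbabilityMeasure P₀] in
theorem dataKernel_comp_blockArray [MeasurableEq Θ] (q : Measure ℕ) (π : Setoid (ObsIndex n))
    {x : Quotient π → Θ} (hx : Function.Injective x) (u : Fin d → ℝ) :
    dataKernel P₀ hmeas q (fun j i => x (blockArray π j i), u)
      = posteriorKernel P₀ hmeas q (groupCount (blockArray π)) (x, u) := by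
  -- The partition also occurs in types, so it is made a variable and the equation is eliminated by
  -- substitution.
  have key : ∀ π', obsPartition (fun j i => x (blockArray π j i)) = π' →
      dataKernel P₀ hmeas q (fun j i => x (blockArray π j i), u)
        = posteriorKernel P₀ hmeas q (groupCount (blockArray π'))
          (blockValues π' fun j i => x (blockArray π j i), u) := by
    rintro _ rfl
    rfl
  rw [key π (obsPartition_comp_blockArray π hx), blockValues_comp_blockArray]

/-- The blocks of equal observations are in bijection with the distinct values. -/
noncomputable def blockEquivDistinctValues (θ : (j : Fin d) → Fin (n j) → Θ) :
    Quotient (obsPartition θ) ≃ distinctValues θ :=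
  Equiv.ofBijective (fun b => ⟨blockValues (obsPartition θ) θ b, by
    simp only [distinctValues, Finset.mem_image, Finset.mem_univ, true_and]
    exact ⟨b.out, rfl⟩⟩) ⟨fun b b' hb => blockValues_injective θ (congrArg Subtype.val hb), by
    rintro ⟨y, hy⟩
    simp only [distinctValues, Finset.mem_image, Finset.mem_univ, true_and] at hy
    obtain ⟨a, rfl⟩ := hy
    exact ⟨blockArray (obsPartition θ) a.1 a.2, Subtype.ext (blockValues_obsPartition θ a.1 a.2)⟩⟩

omit [MeasurableSpace Θ] in
theorem card_distinctValues (θ : (j : Fin d) → Fin (n j) → Θ) :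
    (distinctValues θ).card = Fintype.card (Quotient (obsPartition θ)) := by
  rw [← Fintype.card_coe, Fintype.card_congr (blockEquivDistinctValues θ)]

-- The two laws differ only by the labelling of the atoms, by distinct values or by blocks, and the
-- sum over atoms is invariant under relabelling.
include hmeas hprob in
theorem allocatedLaw_eq_map (θ : (j : Fin d) → Fin (n j) → Θ) {u : Fin d → ℝ} (hu : ∀ j, 0 < u j) :
    allocatedLaw h θ u = (tiltedWeights h (groupCount (blockArray (obsPartition θ))) u).map
      fun s => weightedAtoms s (blockValues (obsPartition θ) θ) := by
  set e := blockEquivDistinctValues θ with he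
  have hN : ∀ j b, groupCount θ j (e b : Θ)
      = groupCount (blockArray (obsPartition θ)) j b := by
    intro j b
    rw [← groupCount_comp _ (blockValues_injective θ)]
    simp_rw [blockValues_obsPartition]
    rfl
  have h1 : allocatedLaw h θ u
      = (tiltedWeights h (fun j (x : distinctValues θ) => groupCount θ j x) u).map
        fun s => weightedAtoms s (fun x : distinctValues θ => (x : Θ)) := rfl
  rw [h1, ← tiltedWeights_map_equiv hmeas hprob hu e, Measure.map_map]
  · simp_rw [hN]
    congr 1
    funext s j
    simp only [Function.comp_apply, weightedAtoms]
    rw [← e.sum_comp]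
    simp only [Equiv.symm_apply_apply]
    rfl
  · exact measurable_weightedAtoms.comp measurable_prodMk_right
  · fun_prop

include hprob in
theorem dataKernel_eq [MeasurableEq Θ] {q : Measure ℕ}
    (θ : (j : Fin d) → Fin (n j) → Θ) {u : Fin d → ℝ}
    (hu : ∀ j, 0 < u j) (h0 : qStarMass q h (distinctValues θ).card u ≠ 0)
    (hfin : qStarMass q h (distinctValues θ).card u ≠ ∞) :
    dataKernel P₀ hmeas q (θ, u) = superpositionLaw (allocatedLaw h θ u)
      (nonallocatedLaw q h P₀ (distinctValues θ).card u) := by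
  rw [card_distinctValues] at *
  rw [dataKernel_apply, posteriorKernel_apply P₀ hmeas hprob _ _ hu h0 hfin,
    allocatedLaw_eq_map hmeas hprob θ hu]

end

/-! ### Bayes' rule for the data kernel, and the exceptional data -/

section

open Classical

variable {Θ : Type*} [MeasurableSpace Θ] [MeasurableEq Θ] (P₀ : Measure Θ)
  [IsProbabilityMeasure P₀] [NullSingletonClass P₀] {d : ℕ}
  {n : Fin d → ℕ} (hn : ∀ j, 0 < n j) {q : Measure ℕ} (hq : q {0} = 0)
  {h : Fin d → ℝ → ℝ} (hmeas : ∀ j, Measurable (h j))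
  (hprob : ∀ j, IsProbabilityMeasure (densityLaw (h j)))

-- Almost every choice of block values is injective, and then the array has partition exactly `π`.
-- So the posterior built from `π` may be replaced by the kernel that sees only the data.
include hprob in
theorem tsum_qStarWeight_mul_partitionIntegral {u : Fin d → ℝ} (hu : ∀ j, 0 < u j)
    (π : Setoid (ObsIndex n)) (hfin : qStarMass q h (Fintype.card (Quotient π)) u ≠ ∞)
    {F : (((j : Fin d) → Fin (n j) → Θ) × (Fin d → ℝ)) × (Fin d → Measure Θ) → ℝ≥0∞}
    (hF : Measurable F) :
    ∑' l, qStarWeight q h (Fintype.card (Quotient π)) u l *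
        partitionIntegral P₀ h u (fun p => F ((p.1, u), p.2)) π l
      = qStarMass q h (Fintype.card (Quotient π)) u *
        ∫⁻ x, ∫⁻ y, F ((fun j i => x (blockArray π j i), u), y)
          ∂(dataKernel P₀ hmeas q (fun j i => x (blockArray π j i), u))
          ∂(Measure.pi fun _ : Quotient π => P₀) := by
  have h1 := tsum_qStarWeight_mul P₀ hmeas hprob (q := q) (groupCount (blockArray π)) hu hfin
    (F := fun p => F ((fun j i => p.1 (blockArray π j i), u), p.2))
    (hF.comp (Measurable.prodMk (by fun_prop) measurable_snd))
  refine h1.trans ?_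
  congr 1
  refine lintegral_congr_ae ?_
  filter_upwards [ae_injective_pi P₀] with x hx
  rw [dataKernel_comp_blockArray P₀ hmeas q π hx]

-- For $F=1$ the joint integral equals one, so its integrand in $u$ is almost everywhere finite.
-- Each normalizing constant occurs there with a nonzero coefficient, hence is finite too.
omit [MeasurableEq Θ] [NullSingletonClass P₀] in
include hn hq hmeas hprob in
theorem ae_qStarMass_ne_top [IsProbabilityMeasure (vecIFPP q (fun j => densityLaw (h j)) P₀)] :
    ∀ᵐ u ∂(gammaVector n), ∀ π : Setoid (ObsIndex n),
      qStarMass q h (Fintype.card (Quotient π)) u ≠ ∞ := by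
  have h1 := lintegral_samplingKernel_vecIFPP (n := n) P₀ hmeas hprob hn hq (F := fun _ => 1)
    measurable_const
  simp only [lintegral_const, measure_univ, mul_one] at h1
  have hI : ∀ u : Fin d → ℝ, (∀ j, 0 < u j) → ∀ (π : Setoid (ObsIndex n)) (l : ℕ),
      partitionIntegral P₀ h u (fun _ => 1) π l = 1 := by
    intro u hu π l
    have := isProbabilityMeasure_markedAtoms P₀ hmeas hprob hu (groupCount (blockArray π))
    have := isProbabilityMeasure_markedAtoms P₀ hmeas hprob hu (fun _ (_ : Fin l) => 0)
    simp [partitionIntegral]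
  have h2 : ∫⁻ u, (∏ j, ENNReal.ofReal (Real.exp (u j))) * ∑ π : Setoid (ObsIndex n),
      tiltedWeightsMass h (groupCount (blockArray π)) u *
        qStarMass q h (Fintype.card (Quotient π)) u ∂(gammaVector n) ≠ ∞ := by
    rw [← lintegral_congr_ae (f := fun u => (∏ j, ENNReal.ofReal (Real.exp (u j))) *
      ∑ π : Setoid (ObsIndex n), tiltedWeightsMass h (groupCount (blockArray π)) u *
        ∑' l, qStarWeight q h (Fintype.card (Quotient π)) u l *
          partitionIntegral P₀ h u (fun _ => 1) π l), ← h1]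
    · exact ENNReal.one_ne_top
    · filter_upwards [ae_pos_gammaVector hn] with u hu
      simp_rw [hI u hu, mul_one]
      rfl
  have hm : Measurable fun u : Fin d → ℝ => (∏ j, ENNReal.ofReal (Real.exp (u j))) *
      ∑ π : Setoid (ObsIndex n), tiltedWeightsMass h (groupCount (blockArray π)) u *
        qStarMass q h (Fintype.card (Quotient π)) u :=
    Measurable.mul (by fun_prop) (Finset.measurable_fun_sum _ fun π _ =>
      (measurable_tiltedWeightsMass hmeas _).mul (measurable_qStarMass hmeas q _))
  filter_upwards [ae_lt_top hm h2] with u hu π htop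
  refine hu.ne (ENNReal.mul_eq_top.2 (Or.inl ⟨?_, ?_⟩))
  · exact Finset.prod_ne_zero_iff.2 fun j _ => by simpa using Real.exp_pos (u j)
  · refine ENNReal.sum_eq_top.2 ⟨π, Finset.mem_univ π, ENNReal.mul_eq_top.2 (Or.inl ⟨?_, htop⟩)⟩
    exact tiltedWeightsMass_ne_zero hmeas hprob _ u

-- Both sides are instances of the same joint integral: the right side tests with the function `G`
-- obtained from `F` by averaging over `dataKernel`. As `G` depends only on the data, averaging it
-- again changes nothing.
include hn hq hprob in
theorem lintegral_samplingKernel_vecIFPP_eq_dataKernel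
    [IsProbabilityMeasure (vecIFPP q (fun j => densityLaw (h j)) P₀)]
    {F : (((j : Fin d) → Fin (n j) → Θ) × (Fin d → ℝ)) × (Fin d → Measure Θ) → ℝ≥0∞}
    (hF : Measurable F) :
    ∫⁻ μ, ∫⁻ p, F (p, μ) ∂(samplingKernel P₀ n μ) ∂(vecIFPP q (fun j => densityLaw (h j)) P₀)
      = ∫⁻ μ, ∫⁻ p, ∫⁻ y, F (p, y) ∂(dataKernel P₀ hmeas q p) ∂(samplingKernel P₀ n μ)
          ∂(vecIFPP q (fun j => densityLaw (h j)) P₀) := by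
  have hG : Measurable fun r : (((j : Fin d) → Fin (n j) → Θ) × (Fin d → ℝ)) × (Fin d → Measure Θ) =>
      ∫⁻ y, F (r.1, y) ∂(dataKernel P₀ hmeas q r.1) :=
    (Measurable.lintegral_kernel_prod_right' hF).comp measurable_fst
  rw [lintegral_samplingKernel_vecIFPP P₀ hmeas hprob hn hq hF,
    lintegral_samplingKernel_vecIFPP P₀ hmeas hprob hn hq hG]
  refine lintegral_congr_ae ?_
  filter_upwards [ae_pos_gammaVector hn, ae_qStarMass_ne_top P₀ hn hq hmeas hprob] with u hu hfin
  congr 1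
  refine Finset.sum_congr rfl fun π _ => ?_
  rw [tsum_qStarWeight_mul_partitionIntegral P₀ hmeas hprob hu π (hfin π) hF,
    tsum_qStarWeight_mul_partitionIntegral P₀ hmeas hprob hu π (hfin π) hG]
  simp

/-- The data for which all `u_j` are positive and `q*_M` is well defined. -/
def regularData (q : Measure ℕ) (h : Fin d → ℝ → ℝ) (n : Fin d → ℕ) (Θ : Type*) :
    Set (((j : Fin d) → Fin (n j) → Θ) × (Fin d → ℝ)) :=
  {p | (∀ j, 0 < p.2 j) ∧ qStarMass q h (distinctValues p.1).card p.2 ≠ 0 ∧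
    qStarMass q h (distinctValues p.1).card p.2 ≠ ∞}

include hmeas in
theorem measurableSet_regularData : MeasurableSet (regularData q h n Θ) := by
  have h1 : Measurable fun p : ((j : Fin d) → Fin (n j) → Θ) × (Fin d → ℝ) =>
      qStarMass q h (distinctValues p.1).card p.2 := by
    have : (fun p : ((j : Fin d) → Fin (n j) → Θ) × (Fin d → ℝ) =>
        qStarMass q h (distinctValues p.1).card p.2)
        = fun p => ∑ π : Setoid (ObsIndex n), if obsPartition p.1 = π then
          qStarMass q h (Fintype.card (Quotient π)) p.2 else 0 := by
      funext p
      rw [Finset.sum_ite_eq, if_pos (Finset.mem_univ _), card_distinctValues]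
    rw [this]
    exact Finset.measurable_fun_sum _ fun π _ => Measurable.ite
      (measurable_fst (measurableSet_obsPartition_eq π))
      ((measurable_qStarMass hmeas q _).comp measurable_snd) measurable_const
  refine MeasurableSet.inter ?_ ((h1 (measurableSet_singleton 0).compl).inter
    (h1 (measurableSet_singleton ∞).compl))
  have h2 : ∀ j, MeasurableSet {p : ((j : Fin d) → Fin (n j) → Θ) × (Fin d → ℝ) | 0 < p.2 j} :=
    fun j => measurableSet_lt measurable_const (by fun_prop)
  have h3 := MeasurableSet.iInter h2
  rwa [← Set.ofPred_forall] at h3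

-- The contribution of each partition has the normalizing constant of $q^*_M$ as a factor, so it
-- vanishes where that constant is zero. Elsewhere, for almost every $u$ and injective block values,
-- the data are regular.
include hn hq hmeas hprob in
theorem lintegral_samplingKernel_irregular
    [IsProbabilityMeasure (vecIFPP q (fun j => densityLaw (h j)) P₀)] :
    ∫⁻ μ, ∫⁻ p, (regularData q h n Θ)ᶜ.indicator (fun _ => 1) p ∂(samplingKernel P₀ n μ)
        ∂(vecIFPP q (fun j => densityLaw (h j)) P₀) = 0 := by
  have hI : Measurable ((regularData q h n Θ)ᶜ.indicator (fun _ => (1 : ℝ≥0∞))) :=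
    measurable_const.indicator (measurableSet_regularData hmeas).compl
  have hF : Measurable fun r : (((j : Fin d) → Fin (n j) → Θ) × (Fin d → ℝ)) × (Fin d → Measure Θ) =>
      (regularData q h n Θ)ᶜ.indicator (fun _ => (1 : ℝ≥0∞)) r.1 := hI.comp measurable_fst
  have h1 := lintegral_samplingKernel_vecIFPP P₀ hmeas hprob hn hq hF
  refine h1.trans ((lintegral_congr_ae ?_).trans lintegral_zero)
  filter_upwards [ae_pos_gammaVector hn, ae_qStarMass_ne_top P₀ hn hq hmeas hprob] with u hu hfin
  refine mul_eq_zero_of_right _ (Finset.sum_eq_zero fun π _ => mul_eq_zero_of_right _ ?_)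
  have h2 := tsum_qStarWeight_mul_partitionIntegral P₀ hmeas hprob hu π (hfin π) hF
  rw [h2]
  by_cases h0 : qStarMass q h (Fintype.card (Quotient π)) u = 0
  · rw [h0, zero_mul]
  refine mul_eq_zero_of_right _ ((lintegral_congr_ae ?_).trans lintegral_zero)
  filter_upwards [ae_injective_pi P₀] with x hx
  rw [Set.indicator_of_notMem]
  · simp
  · rw [Set.notMem_compl_iff]
    have hc : (distinctValues fun j i => x (blockArray π j i)).card = Fintype.card (Quotient π) := by
      rw [card_distinctValues, obsPartition_comp_blockArray π hx]
    refine ⟨hu, ?_⟩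
    simp only [hc]
    exact ⟨h0, hfin π⟩

end

theorem theorem3 {Θ : Type*} [TopologicalSpace Θ] [PolishSpace Θ] [MeasurableSpace Θ]
    [BorelSpace Θ] {d : ℕ} (n : Fin d → ℕ) (hn : ∀ j, 0 < n j)
    (q : Measure ℕ) [IsProbabilityMeasure q] (hq : q {0} = 0)
    (h : Fin d → ℝ → ℝ) (hmeas : ∀ j, Measurable (h j)) (hnonneg : ∀ j, ∀ s, 0 < s → 0 ≤ h j s)
    (hprob : ∀ j, IsProbabilityMeasure (densityLaw (h j)))
    (P₀ : Measure Θ) [IsProbabilityMeasure P₀] [NullSingletonClass P₀]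
    {Ω : Type*} [MeasurableSpace Ω] (P : Measure Ω) [IsProbabilityMeasure P]
    (μ : Ω → Fin d → Measure Θ)
    (θ : Ω → (j : Fin d) → Fin (n j) → Θ) (U : Ω → Fin d → ℝ)
    (hμ : HasLaw μ (vecIFPP q (fun j => densityLaw (h j)) P₀) P)
    (hθU : HasCondLaw (fun ω => (θ ω, U ω)) μ (samplingLaw n) P) :
    HasCondLaw μ (fun ω => (θ ω, U ω))
      (fun p => superpositionLaw (allocatedLaw h p.1 p.2)
        (nonallocatedLaw q h P₀ (distinctValues p.1).card p.2)) P := by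
  have hQ : IsProbabilityMeasure (vecIFPP q (fun j => densityLaw (h j)) P₀) := by
    rw [← hμ.map_eq]
    exact Measure.isProbabilityMeasure_map hμ.aemeasurable
  have hX : AEMeasurable (fun ω => (θ ω, U ω)) P := by
    obtain ⟨κ, hκ, hcond, -⟩ := hθU
    exact hcond.aemeasurable_snd
  have hS : ∀ᵐ ν ∂(vecIFPP q (fun j => densityLaw (h j)) P₀),
      samplingKernel P₀ n ν = samplingLaw n ν := by
    filter_upwards [ae_vecIFPP_pos P₀ hq hprob] with ν hν
    exact samplingKernel_eq_samplingLaw P₀ hn hν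
  refine ⟨dataKernel P₀ hmeas q, inferInstance, ⟨hX.prodMk hμ.aemeasurable, ?_⟩, ?_⟩
  · have := Measure.isProbabilityMeasure_map (μ := P) hX
    refine Measure.ext_of_lintegral _ fun F hF => ?_
    have hG : Measurable fun p : ((j : Fin d) → Fin (n j) → Θ) × (Fin d → ℝ) =>
        ∫⁻ y, F (p, y) ∂(dataKernel P₀ hmeas q p) := Measurable.lintegral_kernel_prod_right' hF
    rw [lintegral_map' hF.aemeasurable (hX.prodMk hμ.aemeasurable), Measure.lintegral_compProd hF,
      lintegral_map' hG.aemeasurable hX, lintegral_of_hasCondLaw hμ hθU _ hS hF,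
      lintegral_samplingKernel_vecIFPP_eq_dataKernel P₀ hn hq hmeas hprob hF]
    exact (lintegral_of_hasCondLaw hμ hθU _ hS (hG.comp measurable_fst)).symm
  -- Testing the joint law with the indicator of irregular data shows that the data are almost
  -- surely regular, and there the kernel is the stated law.
  · have hI : Measurable ((regularData q h n Θ)ᶜ.indicator (fun _ => (1 : ℝ≥0∞))) :=
      measurable_const.indicator (measurableSet_regularData hmeas).compl
    have h0 := (lintegral_of_hasCondLaw hμ hθU _ hS (hI.comp measurable_fst)).trans
      (lintegral_samplingKernel_irregular P₀ hn hq hmeas hprob)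
    simp only [Function.comp_def] at h0
    replace h0 := (lintegral_eq_zero_iff' (hI.comp_aemeasurable hX)).1 h0
    filter_upwards [h0] with ω hω
    have hr := Set.notMem_compl_iff.1 fun hmem => one_ne_zero
      ((Set.indicator_of_mem hmem (fun _ => (1 : ℝ≥0∞))).symm.trans hω)
    exact dataKernel_eq P₀ hmeas hprob (θ ω) hr.1 hr.2.1 hr.2.2
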